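/- \textbf{Setting.} Let $D=D_1\cup\dots\cup D_N\subset\mathbb R^3$ be a system of $N$ disjoint bounded connected open resonators with boundaries of class $C^{1,s}$, $0<s<1$. Let $C$ be its capacitance matrix: $C_{i,j}=-\int_{\partial D_i}\psi_j\,d\sigma$, where $\psi_j\in L^2(\partial D)$ satisfies $-\int_{\partial D}\frac{\psi_j(y)}{4\pi|x-y|}\,d\sigma(y)=\chi_{\partial D_j}(x)$ for almost every $x\in\partial D$. Let $E$ be any real $N\times N$ matrix ($E=0$ is allowed; $E$ represents an error that is neglected when $C$ is replaced by an approximation, such as a dilute-regime one, for which the degeneracy assumed below is exact). Let $\rho_0,\rho_r,\kappa_r,\Omega>0$, $\delta=\rho_r/\rho_0$, $T=2\pi/\Omega$; let $\kappa_1,\dots,\kappa_N>0$ be constants, let $\phi_1,\dots,\phi_N\in\mathbb R$, and let $\rho_i(t)=1/(1+\varepsilon\cos(\Omega t+\phi_i))$. Put $$M_\varepsilon(t)=\frac{\delta\kappa_r}{\rho_r}\,W_1(t)(C+E)W_2(t),\quad (W_1)_{i,i}=\frac{\sqrt{\kappa_i}\,\rho_i(t)}{|D_i|},\quad (W_2)_{i,i}=\frac{\sqrt{\kappa_i}}{\rho_i(t)},\qquad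 A_\varepsilon(t)=\begin{pmatrix}0&\mathrm{Id}\\-M_\varepsilon(t)&0\end{pmatrix}$$ with $W_1,W_2$ diagonal. For real $\varepsilon$ near $0$ let $F_\varepsilon$ be a Floquet matrix of $y'=A_\varepsilon(t)y$, that is, the fundamental solution $X_\varepsilon$ with $X_\varepsilon(0)=\mathrm{Id}$ has the form $X_\varepsilon(t)=Q_\varepsilon(t)e^{F_\varepsilon t}$ with $Q_\varepsilon$ $T$-periodic. Assume that $F_\varepsilon$ is continuous at $\varepsilon=0$ and that all eigenvalues of $F_0$ have imaginary part in $[-\Omega/2,\Omega/2)$. Let $\lambda$ be an eigenvalue of the static matrix $M_0$ with two-dimensional eigenspace, let $\mu^2=-\lambda$, let $\mu=\nu_0+\mathrm i k\Omega$ with $k\in\mathbb Z$ (the folding of $\mu$), and assume that $\nu_0$ is an eigenvalue of $F_0$ of algebraic multiplicity exactly two (the doubly degenerate edge eigenvalue). \textbf{Theorem.} \begin{enumerate} \item The first-order coefficient $A_1(t)=\partial_\varepsilon A_\varepsilon(t)|_{\varepsilon=0}$ exists, is continuous in $t$, and has vanishing constant Fourier coefficient: $\int_0^T A_1(t)\,dt=0$.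 \item The eigenspace of $F_0$ at $\nu_0$ is two-dimensional, $F_\varepsilon$ is differentiable at $\varepsilon=0$ with derivative $F_1$, and $PF_1P=0$, where $P$ is the projection onto $\ker(F_0-\nu_0)$ along the range of $F_0-\nu_0$. \item The eigenvalue $\nu_0$ splits into two eigenvalues $\nu_w(\varepsilon),\nu_q(\varepsilon)$ of $F_\varepsilon$: there is $r>0$ such that, for $\varepsilon$ near $0$, the eigenvalues of $F_\varepsilon$ counted with multiplicity are $\nu_w(\varepsilon)$, $\nu_q(\varepsilon)$ (possibly equal) and others at distance at least $r$ from $\nu_0$. Moreover $\nu_w(0)=\nu_q(0)=\nu_0$, the first-order coefficients vanish, $\nu_1^w=\nu_w'(0)=0$ and $\nu_1^q=\nu_q'(0)=0$, and $\nu_w(\varepsilon)-\nu_0=O(\varepsilon^2)$, $\nu_q(\varepsilon)-\nu_0=O(\varepsilon^2)$ as $\varepsilon\to0$. \end{enumerate} -/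

import Mathlib

open MeasureTheory Filter Topology Asymptotics
open scoped NNReal

namespace TimeModulation

noncomputable section

/-! Resonators in three-dimensional space and their capacitance matrix -/

/-- Euclidean three-space. -/
abbrev Space : Type := EuclideanSpace ℝ (Fin 3)

/-- The boundary of `U` is of Hölder class `C^{1,s}`: near each of its boundary points, `U` is a
strict sublevel set of a function with Hölder continuous differential that does not vanish at the
point. -/
def HasHolderBoundary (s : ℝ≥0) (U : Set Space) : Prop :=
  ∀ x ∈ frontier U, ∃ V : Set Space, IsOpen V ∧ x ∈ V ∧ ∃ g : Space → ℝ,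
    DifferentiableOn ℝ g V ∧ (∃ K : ℝ≥0, HolderOnWith K s (fderiv ℝ g) V) ∧
    fderiv ℝ g x ≠ 0 ∧ U ∩ V = {y ∈ V | g y < 0}

/-- A system of `N` disjoint bounded resonators. -/
structure Resonators (N : ℕ) where
  dom : Fin N → Set Space
  isOpen_dom : ∀ i, IsOpen (dom i)
  isConnected_dom : ∀ i, IsConnected (dom i)
  isBounded_dom : ∀ i, Bornology.IsBounded (dom i)
  disjoint_dom : ∀ i j, i ≠ j → Disjoint (dom i) (dom j)
  boundary_dom : ∃ s : ℝ≥0, 0 < s ∧ s < 1 ∧ ∀ i, HasHolderBoundary s (dom i)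

namespace Resonators

variable {N : ℕ} (D : Resonators N)

/-- The volume `|D_i|`. -/
def vol (i : Fin N) : ℝ := (volume (D.dom i)).toReal

/-- The boundary `∂D`, the union of the boundaries of the resonators. -/
def boundary : Set Space := ⋃ i, frontier (D.dom i)

/-- The surface measure on `∂D`. The factor `π / 4` turns Mathlib's two-dimensional Hausdorff
measure (normalised by squared diameters) into surface area. -/
def surface : Measure Space :=
  ENNReal.ofReal (Real.pi / 4) • (Measure.hausdorffMeasure 2 : Measure Space).restrict D.boundary

/-- The single-layer potential `∫_{∂D} G(x,y) φ(y) dσ(y)` with `G(x,y) = -1/(4π|x-y|)`. -/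
def singleLayer (φ : Space → ℝ) (x : Space) : ℝ :=
  ∫ y, -(1 / (4 * Real.pi * ‖x - y‖)) * φ y ∂D.surface

/-- `ψ` is an `L²(∂D)` density whose single-layer potential has trace `χ_{∂D_j}` on `∂D`. -/
def IsDensity (j : Fin N) (ψ : Space → ℝ) : Prop :=
  MemLp ψ 2 D.surface ∧
    ∀ᵐ x ∂D.surface, D.singleLayer ψ x = (frontier (D.dom j)).indicator (fun _ => (1 : ℝ)) x

open Classical in
/-- The density `ψ_j = (S_D)⁻¹[χ_{∂D_j}]` (unique almost everywhere). -/
def density (j : Fin N) : Space → ℝ :=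
  if h : ∃ ψ, D.IsDensity j ψ then h.choose else 0

/-- The capacitance matrix `C_{i,j} = -∫_{∂D_i} ψ_j dσ`. -/
def capacitance : Matrix (Fin N) (Fin N) ℝ :=
  fun i j => -∫ x in frontier (D.dom i), D.density j x ∂D.surface

end Resonators

/-! The modulated Hill equation -/

section Hill

variable {N : ℕ}

/-- `M(t) = (δ κ_r / ρ_r) W₁(t) C W₂(t) + W₃(t)` for the volumes `vol`, a matrix `C` and
modulations `ρ`, `κ`, where `δ = ρ_r / ρ_0`. -/
def hillMatrix (ρ₀ ρr κr : ℝ) (vol : Fin N → ℝ) (C : Matrix (Fin N) (Fin N) ℝ)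
    (ρ κ : Fin N → ℝ → ℝ) (t : ℝ) : Matrix (Fin N) (Fin N) ℝ :=
  ((ρr / ρ₀) * κr / ρr) •
      (Matrix.diagonal (fun i => √(κ i t) * ρ i t / vol i) * C *
        Matrix.diagonal (fun i => √(κ i t) / ρ i t)) +
    Matrix.diagonal (fun i =>
      √(κ i t) / 2 * deriv (fun s => deriv (κ i) s / (κ i s) ^ (3 / 2 : ℝ)) t)

/-- The modulation `ρ_i(t) = 1 / (1 + ε cos(Ω t + φ_i))`. -/
def rhoMod (Ω : ℝ) (φ : Fin N → ℝ) (ε : ℝ) (i : Fin N) (t : ℝ) : ℝ :=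
  1 / (1 + ε * Real.cos (Ω * t + φ i))

/-- The coefficient matrix `A(t) = [[0, Id], [-M(t), 0]]` of the first-order form of
`Ψ'' + M(t) Ψ = 0`, with complex entries. -/
def firstOrder (M : ℝ → Matrix (Fin N) (Fin N) ℝ) (t : ℝ) :
    Matrix (Fin N ⊕ Fin N) (Fin N ⊕ Fin N) ℂ :=
  Matrix.fromBlocks 0 1 (-((M t).map Complex.ofReal)) 0

end Hill

/-! Floquet matrices -/

section Floquet

variable {n : Type*} [Fintype n] [DecidableEq n]

/-- `X` is the fundamental solution of `x' = A(t) x` with `X(0) = Id`. -/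
def IsFundamentalSolution (A X : ℝ → Matrix n n ℂ) : Prop :=
  X 0 = 1 ∧ ∀ t i j, HasDerivAt (fun s => X s i j) ((A t * X t) i j) t

/-- `F` is a Floquet matrix of the `T`-periodic system `x' = A(t) x`: the fundamental solution
is `X(t) = Q(t) exp(F t)` with `Q` periodic of period `T`. -/
def IsFloquetMatrix (A : ℝ → Matrix n n ℂ) (T : ℝ) (F : Matrix n n ℂ) : Prop :=
  ∃ X Q : ℝ → Matrix n n ℂ, IsFundamentalSolution A X ∧ Function.Periodic Q T ∧
    ∀ t, X t = Q t * NormedSpace.exp ((t : ℂ) • F)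

/-- The normalisation of the static Floquet matrix: the imaginary parts of its eigenvalues lie
in `[-Ω/2, Ω/2)`. -/
def IsFolded (Ω : ℝ) (F : Matrix n n ℂ) : Prop :=
  ∀ z ∈ F.charpoly.roots, z.im ∈ Set.Ico (-(Ω / 2)) (Ω / 2)

/-- The eigenspace of a matrix. -/
def eigSpace (F : Matrix n n ℂ) (z : ℂ) : Submodule ℂ (n → ℂ) :=
  Module.End.eigenspace (Matrix.toLin' F) z

/-- `P` is the projection onto the eigenspace of `F` at `z` along the range of `F - z`. -/
def IsEigenprojection (F : Matrix n n ℂ) (z : ℂ) (P : Matrix n n ℂ) : Prop :=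
  P * P = P ∧ LinearMap.range (Matrix.toLin' P) = eigSpace F z ∧
    LinearMap.ker (Matrix.toLin' P) = LinearMap.range (Matrix.toLin' (F - z • 1))

end Floquet

end

end TimeModulation

/-! Entry (i, j) of M_ε(t) is B_ij (1 + ε cos(Ωt + φ_j)) / (1 + ε cos(Ωt + φ_i)) with constant B_ij.
Its first-order coefficient is B_ij (cos(Ωt + φ_j) - cos(Ωt + φ_i)), of mean zero, so A₁ has mean
zero.

Write a for the static matrix A₀. Perturbation theory (`isBigO_fundamentalSolution`) gives exp(T
F_ε) = X_ε(T) = e^{Ta}(1 + ε ∫ e^{-sa} A₁(s) e^{sa} ds) + O(ε²). Since the spectrum of F₀ lies in a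
half-open strip of height Ω, z ↦ e^{Tz} is injective on it; hence the differential of exp at T F₀ is
injective, and continuity of F_ε yields F_ε = F₀ + ε F₁ + O(ε²) (`exists_isBigO_floquet`). Applying
the same perturbation formula to y' = F_ε y gives ∫ e^{-sF₀} F₁ e^{sF₀} ds = ∫ e^{-sa} A₁(s) e^{sa}
ds.

As e^{TF₀} = e^{Ta}, folding turns eigenvectors of a at μ into eigenvectors of F₀ at ν₀. The
multiplicity two makes these eigenspaces equal and ν₀ semisimple. On the range of P both a and F₀
are scalars, so between two factors P the conjugations cancel: T P F₁ P = P (∫ A₁) P = 0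
(`floquet_edge_expansion`).

Eigenvalues near a semisimple ν₀ with P F₁ P = 0 move by O(ε²) (`exists_norm_eigenvalue_sub_le`),
and continuity of roots leaves exactly two of them near ν₀ (`exists_eigenvalue_splitting`). -/

namespace TimeModulation

/-! ### Exponentials and linear differential equations in a Banach algebra. -/

section BanachAlgebra

open NormedSpace

variable {𝔸 : Type*} [NormedRing 𝔸] [NormedAlgebra ℝ 𝔸] [CompleteSpace 𝔸]

lemma exp_smul_mul_exp_smul_neg (a : 𝔸) (t : ℝ) : exp (t • a) * exp (t • -a) = 1 := by
  let _ : NormedAlgebra ℚ 𝔸 := NormedAlgebra.restrictScalars ℚ ℝ 𝔸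
  have h : Commute (t • a) (t • -a) := by
    simp only [smul_neg]
    exact (Commute.refl _).neg_right
  rw [← exp_add_of_commute h, smul_neg, add_neg_cancel, exp_zero]

lemma exp_smul_neg_mul_exp_smul (a : 𝔸) (t : ℝ) : exp (t • -a) * exp (t • a) = 1 := by
  simpa using exp_smul_mul_exp_smul_neg (-a) t

/-- Distinct exponents cover both intertwining relations and, with b = 0, variation of constants. -/
lemma hasDerivAt_exp_conj (a b : 𝔸) {h : ℝ → 𝔸} {h' : 𝔸} {t : ℝ} (hh : HasDerivAt h h' t) :
    HasDerivAt (fun s : ℝ => exp (s • a) * h s * exp (s • -b))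
      (exp (t • a) * (a * h t + h' - h t * b) * exp (t • -b)) t := by
  have := ((hasDerivAt_exp_smul_const (𝕂 := ℝ) a t).mul hh).mul
    (hasDerivAt_exp_smul_const' (𝕂 := ℝ) (-b) t)
  refine this.congr_deriv ?_
  change (_ * _ * h t + _) * _ + exp (t • a) * h t * _ = _
  noncomm_ring

lemma exp_conj_eq {a b h : 𝔸} (H : a * h = h * b) (t : ℝ) :
    exp (t • a) * h * exp (t • -b) = h := by
  have hd : ∀ s : ℝ, HasDerivAt (fun s : ℝ => exp (s • a) * h * exp (s • -b)) 0 s := fun s => by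
    simpa [H] using hasDerivAt_exp_conj a b (hasDerivAt_const s h)
  have := is_const_of_deriv_eq_zero (fun s => (hd s).differentiableAt) (fun s => (hd s).deriv) t 0
  simpa using this

/-- The exponential intertwines whatever its arguments intertwine. -/
lemma exp_smul_mul_eq_mul_exp_smul {a b h : 𝔸} (H : a * h = h * b) (t : ℝ) :
    exp (t • a) * h = h * exp (t • b) := by
  have := congrArg (· * exp (t • b)) (exp_conj_eq H t)
  simpa only [mul_assoc, exp_smul_neg_mul_exp_smul, mul_one] using this

lemma exp_mul_eq_mul_exp {a b h : 𝔸} (H : a * h = h * b) : exp a * h = h * exp b := by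
  simpa using exp_smul_mul_eq_mul_exp_smul H 1

/-- If `a h - h b = k` and `a k = k b`, then `e^a h e^{-b} = h + k`. -/
lemma exp_mul_mul_exp_neg_of_nilpotent {a b h k : 𝔸} (hk : a * h - h * b = k)
    (H : a * k = k * b) : exp a * h * exp (-b) = h + k := by
  -- The conjugate has derivative e^{sa} k e^{-sb}, which is k because k intertwines a and b.
  have hd : ∀ s : ℝ, HasDerivAt (fun s : ℝ => exp (s • a) * h * exp (s • -b) - s • k) 0 s :=
    fun s => by
      have h1 := (hasDerivAt_exp_conj a b (hasDerivAt_const s h)).sub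
        ((hasDerivAt_id s).smul_const k)
      refine h1.congr_deriv ?_
      rw [add_zero, hk, exp_conj_eq H s, one_smul, sub_self]
  have := is_const_of_deriv_eq_zero (fun s => (hd s).differentiableAt) (fun s => (hd s).deriv) 1 0
  simpa [sub_eq_iff_eq_add] using this

/-- A two-sided multiplication that turns `a` into a central element removes a conjugation by
the exponential of `a`. -/
lemma mul_integral_exp_conj_mul {a P m : 𝔸} (hm : ∀ x, m * x = x * m) (haP : a * P = P * m)
    (hPa : P * a = m * P) {b : ℝ → 𝔸} (hb : Continuous b) (T : ℝ) :
    P * (∫ s in (0 : ℝ)..T, exp (s • -a) * b s * exp (s • a)) * P =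
      P * (∫ s in (0 : ℝ)..T, b s) * P := by
  have hcont : ∀ b : 𝔸, Continuous fun s : ℝ => exp (s • b) := fun b =>
    (differentiable_exp_smul_const ℝ b).continuous
  have hint : Continuous fun s : ℝ => exp (s • -a) * b s * exp (s • a) :=
    ((hcont _).mul hb).mul (hcont _)
  set L : 𝔸 →L[ℝ] 𝔸 := (ContinuousLinearMap.mulLeftRight ℝ 𝔸 P P) with hL
  have hLa : ∀ x, L x = P * x * P := fun x => by simp [hL]
  rw [← hLa, ← hLa, ← L.intervalIntegral_comp_comm (hint.intervalIntegrable _ _),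
    ← L.intervalIntegral_comp_comm (hb.intervalIntegrable _ _)]
  refine intervalIntegral.integral_congr fun s _ => ?_
  -- Moving the exponentials past P replaces a by the central m, and exponentials of ±m cancel
  -- around any element.
  have h1 : exp (s • a) * P = P * exp (s • m) := exp_smul_mul_eq_mul_exp_smul haP s
  have h2 : exp (s • -m) * P = P * exp (s • -a) :=
    exp_smul_mul_eq_mul_exp_smul (by rw [neg_mul, mul_neg, hPa]) s
  have h3 : exp (s • -m) * (P * b s * P) = P * b s * P * exp (s • -m) :=
    exp_smul_mul_eq_mul_exp_smul (by rw [neg_mul, mul_neg, hm]) s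
  simp only [hLa]
  calc P * (exp (s • -a) * b s * exp (s • a)) * P
      = (P * exp (s • -a)) * b s * (exp (s • a) * P) := by simp only [mul_assoc]
    _ = exp (s • -m) * (P * b s * P) * exp (s • m) := by rw [h1, ← h2]; simp only [mul_assoc]
    _ = P * b s * P := by rw [h3, mul_assoc, exp_smul_neg_mul_exp_smul, mul_one]

/-- First-order perturbation theory for `X' = A_ε(t) X`, `X(0) = 1` with
`A_ε(t) = a + ε a₁(t) + O(ε²)`. -/
lemma isBigO_fundamentalSolution {a : 𝔸} {a₁ : ℝ → 𝔸} (ha₁ : Continuous a₁)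
    {A X : ℝ → ℝ → 𝔸} {T K : ℝ} (hT : 0 ≤ T)
    (hA : ∀ᶠ ε in 𝓝 (0 : ℝ), ∀ t ∈ Set.Icc 0 T, ‖A ε t - a - ε • a₁ t‖ ≤ K * ε ^ 2)
    (hX₀ : ∀ᶠ ε in 𝓝 (0 : ℝ), X ε 0 = 1)
    (hX : ∀ᶠ ε in 𝓝 (0 : ℝ), ∀ t, HasDerivAt (X ε) (A ε t * X ε t) t) :
    (fun ε => X ε T - exp (T • a) *
      (1 + ε • ∫ s in (0 : ℝ)..T, exp (s • -a) * a₁ s * exp (s • a)))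
      =O[𝓝 0] fun ε : ℝ => ε ^ 2 := by
  have hcont : ∀ b : 𝔸, Continuous fun s : ℝ => exp (s • b) := fun b =>
    (differentiable_exp_smul_const ℝ b).continuous
  have hbd : ∀ f : ℝ → 𝔸, Continuous f → ∃ C, 0 ≤ C ∧ ∀ t ∈ Set.Icc 0 T, ‖f t‖ ≤ C := by
    intro f hf
    obtain ⟨C, hC⟩ := isCompact_Icc.exists_bound_of_continuousOn (hf.continuousOn (s := Set.Icc 0 T))
    exact ⟨max C 0, le_max_right _ _, fun t ht => (hC t ht).trans (le_max_left _ _)⟩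
  obtain ⟨KE, hKE, hE⟩ := hbd _ (hcont (-a))
  obtain ⟨KG, hKG, hG⟩ := hbd _ (hcont a)
  obtain ⟨K₁, hK₁, h₁⟩ := hbd _ ha₁
  have hint : Continuous fun s : ℝ => exp (s • -a) * a₁ s * exp (s • a) :=
    ((hcont _).mul ha₁).mul (hcont _)
  set I : ℝ → 𝔸 := fun t => ∫ s in (0 : ℝ)..t, exp (s • -a) * a₁ s * exp (s • a) with hI
  have hId : ∀ t, HasDerivAt I (exp (t • -a) * a₁ t * exp (t • a)) t := fun t =>
    intervalIntegral.integral_hasDerivAt_right (hint.intervalIntegrable _ _)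
      (hint.stronglyMeasurableAtFilter _ _) hint.continuousAt
  -- For |ε| ≤ 1, c |ε| bounds the coefficient of the equation for Z = e^{-ta} X, KZ bounds Z by
  -- Grönwall, and C ε² bounds the derivative of the remainder Z - 1 - ε I.
  set c : ℝ := KE * (K₁ + |K|) * KG with hc
  have hc0 : 0 ≤ c := by positivity
  set KZ : ℝ := ‖(1 : 𝔸)‖ * Real.exp (c * T) with hKZ
  have hKZ0 : 0 ≤ KZ := by positivity
  set C : ℝ := KE * |K| * KG * KZ + KE * K₁ * KG * (c * KZ * T) with hC
  have hsmall : ∀ᶠ ε in 𝓝 (0 : ℝ), |ε| ≤ 1 := by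
    filter_upwards [Metric.closedBall_mem_nhds (0 : ℝ) one_pos] with ε hε
    simpa using hε
  refine IsBigO.of_bound (KG * (C * T)) ?_
  filter_upwards [hA, hX₀, hX, hsmall] with ε hA hX₀ hX hε
  set Z : ℝ → 𝔸 := fun t => exp (t • -a) * X ε t with hZ
  have hGZ : ∀ t, X ε t = exp (t • a) * Z t := fun t => by
    rw [hZ, ← mul_assoc, exp_smul_mul_exp_smul_neg, one_mul]
  have hZ0 : Z 0 = 1 := by simp [hZ, hX₀]
  have hZd : ∀ t, HasDerivAt Z (exp (t • -a) * (A ε t - a) * exp (t • a) * Z t) t := fun t => by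
    have := hasDerivAt_exp_conj (-a) 0 (hX t)
    simp only [neg_zero, smul_zero, exp_zero, mul_one, mul_zero, sub_zero] at this
    convert this using 1
    rw [mul_assoc _ _ (Z t), ← hGZ]
    noncomm_ring
  have hε2 : ε ^ 2 ≤ |ε| := by
    rw [← sq_abs]; nlinarith [abs_nonneg ε]
  have hAa : ∀ t ∈ Set.Icc 0 T, ‖A ε t - a‖ ≤ |ε| * (K₁ + |K|) := fun t ht => by
    calc ‖A ε t - a‖ = ‖(A ε t - a - ε • a₁ t) + ε • a₁ t‖ := by rw [sub_add_cancel]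
      _ ≤ K * ε ^ 2 + |ε| * K₁ := by
          refine (norm_add_le _ _).trans (add_le_add (hA t ht) ?_)
          rw [norm_smul, Real.norm_eq_abs]
          exact mul_le_mul_of_nonneg_left (h₁ t ht) (abs_nonneg _)
      _ ≤ |ε| * (K₁ + |K|) := by
          have : K * ε ^ 2 ≤ |K| * |ε| :=
            (mul_le_mul_of_nonneg_right (le_abs_self K) (sq_nonneg ε)).trans
              (mul_le_mul_of_nonneg_left hε2 (abs_nonneg K))
          linarith
  have hconj : ∀ t ∈ Set.Icc 0 T, ∀ b : 𝔸, ‖exp (t • -a) * b * exp (t • a)‖ ≤ KE * ‖b‖ * KG :=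
    fun t ht b => by
      refine (norm_mul_le _ _).trans ?_
      refine mul_le_mul ((norm_mul_le _ _).trans ?_) (hG t ht) (norm_nonneg _) (by positivity)
      exact mul_le_mul_of_nonneg_right (hE t ht) (norm_nonneg _)
  have hconjA : ∀ t ∈ Set.Icc 0 T, ‖exp (t • -a) * (A ε t - a) * exp (t • a)‖ ≤ c * |ε| :=
    fun t ht => by
      refine (hconj t ht _).trans ?_
      calc KE * ‖A ε t - a‖ * KG ≤ KE * (|ε| * (K₁ + |K|)) * KG := by
            gcongr; exact hAa t ht
        _ = c * |ε| := by rw [hc]; ring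
  have hZbd : ∀ t ∈ Set.Icc 0 T, ‖Z t‖ ≤ KZ := fun t ht => by
    have := norm_le_gronwallBound_of_norm_deriv_right_le (f := Z) (δ := ‖(1 : 𝔸)‖) (K := c)
      (ε := 0) (a := 0) (b := T) (fun t _ => (hZd t).continuousAt.continuousWithinAt)
      (fun t _ => (hZd t).hasDerivWithinAt) (by rw [hZ0]) (fun t ht => by
        rw [add_zero]
        refine (norm_mul_le _ _).trans (mul_le_mul_of_nonneg_right ?_ (norm_nonneg _))
        exact (hconjA t ⟨ht.1, ht.2.le⟩).trans (mul_le_of_le_one_right hc0 hε)) t ht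
    rw [gronwallBound_ε0, sub_zero] at this
    refine this.trans ?_
    rw [hKZ]
    gcongr
    exact ht.2
  have hZ1 : ∀ t ∈ Set.Icc 0 T, ‖Z t - 1‖ ≤ c * |ε| * KZ * T := fun t ht => by
    have := norm_image_sub_le_of_norm_deriv_le_segment' (f := Z) (a := 0) (b := T)
      (C := c * |ε| * KZ) (fun t _ => (hZd t).hasDerivWithinAt) (fun t ht => by
        have ht' : t ∈ Set.Icc 0 T := ⟨ht.1, ht.2.le⟩
        exact (norm_mul_le _ _).trans
          (mul_le_mul (hconjA t ht') (hZbd t ht') (norm_nonneg _) (by positivity))) t ht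
    rw [hZ0, sub_zero] at this
    exact this.trans (mul_le_mul_of_nonneg_left ht.2 (by positivity))
  have hR : ‖Z T - 1 - ε • I T‖ ≤ C * ε ^ 2 * T := by
    -- Both terms are O(ε²): the first by the hypothesis on A, the second because Z - 1 is already
    -- O(ε).
    have hRd : ∀ t, HasDerivAt (fun t => Z t - 1 - ε • I t)
        (exp (t • -a) * (A ε t - a - ε • a₁ t) * exp (t • a) * Z t +
          ε • (exp (t • -a) * a₁ t * exp (t • a) * (Z t - 1))) t := fun t => by
      have := ((hZd t).sub_const 1).sub ((hId t).const_smul ε)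
      refine this.congr_deriv ?_
      simp only [mul_sub, sub_mul, smul_sub, mul_one, smul_mul_assoc, mul_smul_comm]
      abel
    have := norm_image_sub_le_of_norm_deriv_le_segment' (f := fun t => Z t - 1 - ε • I t)
      (a := 0) (b := T) (C := C * ε ^ 2) (fun t _ => (hRd t).hasDerivWithinAt) (fun t ht => by
        have ht' : t ∈ Set.Icc 0 T := ⟨ht.1, ht.2.le⟩
        have e1 : ‖exp (t • -a) * (A ε t - a - ε • a₁ t) * exp (t • a) * Z t‖ ≤
            KE * (|K| * ε ^ 2) * KG * KZ := by
          refine (norm_mul_le _ _).trans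
            (mul_le_mul ((hconj t ht' _).trans ?_) (hZbd t ht') (norm_nonneg _) (by positivity))
          gcongr
          exact (hA t ht').trans (mul_le_mul_of_nonneg_right (le_abs_self K) (sq_nonneg ε))
        have e2 : ‖ε • (exp (t • -a) * a₁ t * exp (t • a) * (Z t - 1))‖ ≤
            |ε| * (KE * K₁ * KG * (c * |ε| * KZ * T)) := by
          rw [norm_smul, Real.norm_eq_abs]
          refine mul_le_mul_of_nonneg_left ((norm_mul_le _ _).trans
            (mul_le_mul ((hconj t ht' _).trans ?_) (hZ1 t ht') (norm_nonneg _) (by positivity)))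
            (abs_nonneg _)
          gcongr
          exact h₁ t ht'
        refine (norm_add_le _ _).trans ((add_le_add e1 e2).trans (le_of_eq ?_))
        rw [hC, ← sq_abs]; ring) T ⟨hT, le_rfl⟩
    simpa [hZ0, hI] using this
  have : X ε T - exp (T • a) * (1 + ε • I T) = exp (T • a) * (Z T - 1 - ε • I T) := by
    rw [hGZ]; noncomm_ring
  rw [this, Real.norm_eq_abs, abs_of_nonneg (sq_nonneg ε)]
  calc _ ≤ KG * (C * ε ^ 2 * T) := (norm_mul_le _ _).trans
        (mul_le_mul (hG T ⟨hT, le_rfl⟩) hR (norm_nonneg _) hKG)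
    _ = _ := by ring

/-- The exponential is analytic, and `partialSum 2` stops after the linear term. -/
lemma isBigO_exp_sub_fderiv (a : 𝔸) :
    (fun h => exp (a + h) - exp a - fderiv ℝ exp a h) =O[𝓝 (0 : 𝔸)] fun h => ‖h‖ ^ 2 := by
  obtain ⟨p, hp⟩ := exp_analytic (𝕂 := ℝ) a
  have := hp.isBigO_sub_partialSum_pow 2
  have h1 : ∀ h, p.partialSum 2 h = exp a + fderiv ℝ exp a h := fun h => by
    rw [hp.fderiv_eq, FormalMultilinearSeries.partialSum, Finset.sum_range_succ,
      Finset.sum_range_one, hp.coeff_zero]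
    rfl
  simpa only [h1, sub_sub] using this

/-- The differential of the exponential at `a` in a direction that commutes with `exp a` only
if it commutes with `a` is injective. -/
lemma fderiv_exp_injective {a : 𝔸} (ha : ∀ h, exp a * h = h * exp a → a * h = h * a) :
    Function.Injective (fderiv ℝ (exp : 𝔸 → 𝔸) a) := by
  let _ : NormedAlgebra ℚ 𝔸 := NormedAlgebra.restrictScalars ℚ ℝ 𝔸
  refine (injective_iff_map_eq_zero _).2 fun h hh => ?_
  have hd : HasFDerivAt exp (fderiv ℝ exp a) a :=
    (exp_analytic (𝕂 := ℝ) a).differentiableAt.hasFDerivAt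
  have hline : HasDerivAt (fun s : ℝ => a + s • h) h 0 := by
    simpa using ((hasDerivAt_id (0 : ℝ)).smul_const h).const_add a
  have hd0 : HasDerivAt (fun s : ℝ => exp (a + s • h)) (fderiv ℝ exp a h) 0 := by
    have hd' : HasFDerivAt exp (fderiv ℝ exp a) (a + (0 : ℝ) • h) := by simpa using hd
    exact hd'.comp_hasDerivAt (0 : ℝ) hline
  rw [hh] at hd0
  -- Differentiate (a + sh) exp(a + sh) = exp(a + sh) (a + sh) at s = 0; the derivative of the
  -- exponential drops out because h is in the kernel.
  have hcomm : exp a * h = h * exp a := by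
    have h1 := hline.mul hd0
    have h2 := hd0.mul hline
    have h3 : (fun s : ℝ => (a + s • h)) * (fun s : ℝ => exp (a + s • h)) =
        (fun s : ℝ => exp (a + s • h)) * fun s : ℝ => (a + s • h) := by
      ext s
      exact ((Commute.refl (a + s • h)).exp_right).eq
    rw [h3] at h1
    simpa using h2.unique h1
  have hc : Commute a h := ha h hcomm
  -- Once h commutes with a, the exponential factors and the derivative is exp a * h, with exp a a
  -- unit.
  have h4 : HasDerivAt (fun s : ℝ => exp (a + s • h)) (exp a * h) 0 := by
    have h5 := (hasDerivAt_exp_smul_const (𝕂 := ℝ) h 0).const_mul (exp a)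
    simp only [zero_smul, exp_zero, one_mul] at h5
    convert h5 using 1
    ext s
    exact exp_add_of_commute (hc.smul_right s)
  have h6 : exp a * h = 0 := h4.unique hd0
  exact (isUnit_exp a).mul_right_eq_zero.1 h6

end BanachAlgebra

/-! ### First-order expansions with quadratic remainder. -/

section Expansions

variable {V : Type*} [NormedAddCommGroup V] [NormedSpace ℝ V]

lemma hasDerivAt_of_isBigO_sq {f : ℝ → V} {f' : V}
    (h : (fun ε => f ε - f 0 - ε • f') =O[𝓝 0] fun ε : ℝ => ε ^ 2) : HasDerivAt f f' 0 := by
  rw [hasDerivAt_iff_isLittleO]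
  simp only [sub_zero]
  exact h.trans_isLittleO (isLittleO_pow_id one_lt_two)

lemma eq_zero_of_smul_isBigO_sq {v : V}
    (h : (fun ε : ℝ => ε • v) =O[𝓝 0] fun ε : ℝ => ε ^ 2) : v = 0 := by
  have h1 : HasDerivAt (fun ε : ℝ => ε • v) 0 0 := hasDerivAt_of_isBigO_sq (by simpa using h)
  have h2 : HasDerivAt (fun ε : ℝ => ε • v) v 0 := by
    simpa using (hasDerivAt_id (0 : ℝ)).smul_const v
  exact h2.unique h1

/-- A continuous branch of the inverse of a function with injective differential has a
first-order expansion where the function has one. -/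
lemma exists_isBigO_of_injective [FiniteDimensional ℝ V] {f : V → V} {a y : V} {L : V →L[ℝ] V}
    (hL : Function.Injective L)
    (hf : (fun h => f (a + h) - f a - L h) =O[𝓝 (0 : V)] fun h => ‖h‖ ^ 2)
    {u : ℝ → V} (hu : Tendsto u (𝓝 0) (𝓝 a))
    (hy : (fun ε => f (u ε) - f a - ε • y) =O[𝓝 0] fun ε : ℝ => ε ^ 2) :
    ∃ u₁ : V, (fun ε => u ε - a - ε • u₁) =O[𝓝 0] fun ε : ℝ => ε ^ 2 := by
  obtain ⟨C, -, hC⟩ := (LinearMap.injective_iff_antilipschitz L.toLinearMap).1 hL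
  have hbd : ∀ v, ‖v‖ ≤ C * ‖L v‖ := fun v => by
    simpa using hC.le_mul_dist v 0
  obtain ⟨u₁, hu₁⟩ := (LinearMap.injective_iff_surjective (f := L.toLinearMap)).1 hL y
  replace hu₁ : L u₁ = y := hu₁
  have hh : Tendsto (fun ε => u ε - a) (𝓝 0) (𝓝 0) := by simpa using hu.sub_const a
  have hrem : (fun ε => f (u ε) - f a - L (u ε - a)) =O[𝓝 0] fun ε => ‖u ε - a‖ ^ 2 := by
    simpa [Function.comp_def] using hf.comp_tendsto hh
  have hsq : (fun ε : ℝ => ε ^ 2) =O[𝓝 0] fun ε : ℝ => ε :=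
    (isLittleO_pow_id one_lt_two).isBigO
  have hg : (fun ε => f (u ε) - f a) =O[𝓝 0] fun ε : ℝ => ε := by
    have h1 : (fun ε : ℝ => ε • y) =O[𝓝 0] fun ε : ℝ => ε := by
      simpa using (isBigO_refl (fun ε : ℝ => ε) (𝓝 0)).smul
        (isBigO_const_const y (one_ne_zero (α := ℝ)) (𝓝 0))
    simpa using (hy.trans hsq).add h1
  have hhL : (fun ε => u ε - a) =O[𝓝 0] fun ε => L (u ε - a) :=
    IsBigO.of_bound C (Eventually.of_forall fun ε => hbd _)
  -- L is bounded below and u tends to a, so the quadratic remainder is negligible against L (u -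
  -- a). Hence L (u - a) is of the size of f (u) - f (a), that is O(ε).
  have hlo : (fun ε => ‖u ε - a‖ ^ 2) =o[𝓝 0] fun ε => L (u ε - a) := by
    have : (fun ε => ‖u ε - a‖ ^ 2) =o[𝓝 0] fun ε => ‖u ε - a‖ :=
      (isLittleO_pow_id one_lt_two).comp_tendsto (by simpa using hh.norm)
    exact (this.trans_isBigO (isBigO_refl _ _).norm_left).trans_isBigO hhL
  have hLO : (fun ε => L (u ε - a)) =O[𝓝 0] fun ε : ℝ => ε := by
    have h1 := (hrem.trans_isLittleO hlo).neg_left.right_isBigO_sub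
    refine (h1.congr_right fun ε => ?_).trans hg
    abel
  have hO2 : (fun ε => ‖u ε - a‖ ^ 2) =O[𝓝 0] fun ε : ℝ => ε ^ 2 :=
    ((hhL.trans hLO).norm_left).pow 2
  refine ⟨u₁, (IsBigO.of_bound C (Eventually.of_forall fun ε => hbd _)).trans
    (g := fun ε => L (u ε - a - ε • u₁)) ?_⟩
  refine (hy.sub (hrem.trans hO2)).congr_left fun ε => ?_
  rw [map_sub L (u ε - a), map_smul, hu₁]
  abel

end Expansions

/-! ### Second-order motion of a semisimple eigenvalue. -/

section EigenvalueEstimate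

variable {𝔸 : Type*} [NormedRing 𝔸] [NormedAlgebra ℂ 𝔸]

/-- If the first-order perturbation of a semisimple eigenvalue vanishes, the eigenvalues nearby
move only at second order. -/
lemma exists_norm_eigenvalue_sub_le {a P S f₁ : 𝔸} {ν : ℂ} (hP : P * P = P) (haP : a * P = ν • P)
    (hPa : P * a = ν • P) (hS : S * (a - ν • 1) = 1 - P) (h₁ : P * f₁ * P = 0) {u : ℝ → 𝔸}
    (hu : (fun ε => u ε - a - (ε : ℂ) • f₁) =O[𝓝 0] fun ε : ℝ => ε ^ 2) :
    ∃ r > 0, ∃ K : ℝ, ∀ᶠ ε in 𝓝 (0 : ℝ), ∀ (z : ℂ) (H : 𝔸), H ≠ 0 → u ε * H = z • H →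
      dist z ν ≤ r → ‖z - ν‖ ≤ K * ε ^ 2 := by
  obtain ⟨c₀, hc₀, hu⟩ := hu.exists_pos
  set cg : ℝ := c₀ + ‖f₁‖ with hcg
  have hcg0 : 0 ≤ cg := by positivity
  set c₁ : ℝ := 2 * ‖S‖ * ‖1 - P‖ * cg with hc₁
  have hc₁0 : 0 ≤ c₁ := by positivity
  -- The radius makes ‖z - ν‖ ‖S‖ ≤ 1/2, so that term can be absorbed when estimating (1 - P) H; the
  -- factor 2 in K comes from ‖H‖ ≤ 2 ‖P H‖.
  refine ⟨1 / (2 * (‖S‖ + 1)), by positivity, 2 * (‖P‖ * c₀ * ‖P‖ + ‖P‖ * cg * c₁), ?_⟩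
  have hsmall : ∀ᶠ ε in 𝓝 (0 : ℝ), |ε| ≤ min 1 (1 / (2 * (c₁ + 1))) := by
    filter_upwards [Metric.closedBall_mem_nhds (0 : ℝ)
      (show 0 < min 1 (1 / (2 * (c₁ + 1))) by positivity)] with ε hε
    simpa using hε
  filter_upwards [hu.bound, hsmall] with ε hu hε z H hH hz hr
  have hε1 : |ε| ≤ 1 := hε.trans (min_le_left _ _)
  have hε2 : c₁ * |ε| ≤ 1 / 2 := by
    calc c₁ * |ε| ≤ c₁ * (1 / (2 * (c₁ + 1))) :=
          mul_le_mul_of_nonneg_left (hε.trans (min_le_right _ _)) hc₁0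
      _ ≤ 1 / 2 := by
          rw [mul_one_div, div_le_div_iff₀ (by positivity) two_pos]; linarith
  have hεsq : ‖ε ^ 2‖ = |ε| ^ 2 := by rw [Real.norm_eq_abs, abs_pow]
  rw [hεsq] at hu
  rw [← sq_abs ε]
  set g : 𝔸 := u ε - a with hg
  set w : ℂ := z - ν with hw
  have hwr : ‖w‖ ≤ 1 / (2 * (‖S‖ + 1)) := by rwa [dist_eq_norm] at hr
  have hgn : ‖g‖ ≤ cg * |ε| := by
    calc ‖g‖ = ‖(g - (ε : ℂ) • f₁) + (ε : ℂ) • f₁‖ := by rw [sub_add_cancel]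
      _ ≤ c₀ * |ε| ^ 2 + |ε| * ‖f₁‖ := by
          refine (norm_add_le _ _).trans (add_le_add hu ?_)
          rw [norm_smul, Complex.norm_real, Real.norm_eq_abs]
      _ ≤ cg * |ε| := by
          have : |ε| ^ 2 ≤ |ε| := by nlinarith [abs_nonneg ε]
          rw [hcg]; nlinarith
  have hgH : (a - ν • 1) * H = w • H - g * H := by
    rw [hg, hw]
    simp only [sub_mul, hz, sub_smul, smul_mul_assoc, one_mul]
    abel
  set H' : 𝔸 := (1 - P) * H with hH'
  have hcomm : (a - ν • 1) * (1 - P) = (1 - P) * (a - ν • 1) := by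
    simp only [mul_sub, sub_mul, haP, hPa, smul_mul_assoc, mul_smul_comm, one_mul, mul_one,
      smul_sub, sub_self, sub_zero]
    abel
  -- S inverts a - ν off the eigenspace, so this component of H is O(ε).
  have hH'eq : H' = w • (S * H') - S * (1 - P) * (g * H) := by
    have h1 : S * ((a - ν • 1) * H') = H' := by
      rw [← mul_assoc, hS, hH', ← mul_assoc]
      congr 1
      simp [mul_sub, sub_mul, hP]
    have h2 : (a - ν • 1) * H' = w • H' - (1 - P) * (g * H) := by
      rw [hH', ← mul_assoc, hcomm, mul_assoc, hgH, mul_sub, mul_smul_comm]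
    rw [h2, mul_sub, mul_smul_comm, ← mul_assoc S (1 - P) (g * H)] at h1
    exact h1.symm
  have hgHn : ‖g * H‖ ≤ cg * |ε| * ‖H‖ :=
    (norm_mul_le _ _).trans (mul_le_mul_of_nonneg_right hgn (norm_nonneg _))
  have hH'n : ‖H'‖ ≤ c₁ * |ε| * ‖H‖ := by
    have h1 : ‖H'‖ ≤ ‖w‖ * (‖S‖ * ‖H'‖) + ‖S‖ * ‖1 - P‖ * (cg * |ε| * ‖H‖) := by
      calc ‖H'‖ = ‖w • (S * H') - S * (1 - P) * (g * H)‖ := by rw [← hH'eq]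
        _ ≤ _ := by
          refine (norm_sub_le _ _).trans (add_le_add ?_ ?_)
          · rw [norm_smul]
            exact mul_le_mul_of_nonneg_left (norm_mul_le _ _) (norm_nonneg _)
          · exact (norm_mul_le _ _).trans
              (mul_le_mul (norm_mul_le _ _) hgHn (norm_nonneg _) (by positivity))
    have h2 : ‖w‖ * ‖S‖ ≤ 1 / 2 := by
      calc ‖w‖ * ‖S‖ ≤ 1 / (2 * (‖S‖ + 1)) * ‖S‖ :=
            mul_le_mul_of_nonneg_right hwr (norm_nonneg _)
        _ ≤ 1 / 2 := by
          rw [div_mul_eq_mul_div, div_le_div_iff₀ (by positivity) two_pos]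
          linarith [norm_nonneg S]
    have h3 := mul_le_mul_of_nonneg_right h2 (norm_nonneg H')
    rw [hc₁]; nlinarith
  have hPH : ‖H‖ / 2 ≤ ‖P * H‖ := by
    have h1 : ‖H‖ ≤ ‖P * H‖ + ‖H'‖ := by
      calc ‖H‖ = ‖P * H + H'‖ := by rw [hH', sub_mul, one_mul, add_sub_cancel]
        _ ≤ _ := norm_add_le _ _
    have h2 := mul_le_mul_of_nonneg_right hε2 (norm_nonneg H)
    linarith
  -- P kills a - ν and P f₁ P = 0, so no first-order term is left: g - ε f₁ is O(ε²), and in the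
  -- last product g and H' are each O(ε).
  have hwPH : w • (P * H) = P * (g - (ε : ℂ) • f₁) * P * H + P * (g * H') := by
    have h1 : P * (g - (ε : ℂ) • f₁) * P = P * g * P := by
      simp [mul_sub, sub_mul, h₁]
    have h2 : P * ((a - ν • 1) * H) = 0 := by
      rw [← mul_assoc, mul_sub, hPa, mul_smul_comm, mul_one, sub_self, zero_mul]
    rw [hgH, mul_sub, mul_smul_comm, sub_eq_zero] at h2
    rw [h1, h2, hH']
    noncomm_ring
  have hbound : ‖w‖ * ‖P * H‖ ≤ (‖P‖ * c₀ * ‖P‖ + ‖P‖ * cg * c₁) * |ε| ^ 2 * ‖H‖ := by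
    rw [← norm_smul, hwPH]
    have h1 : ‖P * (g - (ε : ℂ) • f₁) * P * H‖ ≤ ‖P‖ * (c₀ * |ε| ^ 2) * ‖P‖ * ‖H‖ := by
      refine (norm_mul_le _ _).trans (mul_le_mul_of_nonneg_right ?_ (norm_nonneg _))
      refine (norm_mul_le _ _).trans (mul_le_mul_of_nonneg_right ?_ (norm_nonneg _))
      exact (norm_mul_le _ _).trans (mul_le_mul_of_nonneg_left hu (norm_nonneg _))
    have h2 : ‖P * (g * H')‖ ≤ ‖P‖ * (cg * |ε| * (c₁ * |ε| * ‖H‖)) := by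
      refine (norm_mul_le _ _).trans (mul_le_mul_of_nonneg_left ?_ (norm_nonneg _))
      exact (norm_mul_le _ _).trans (mul_le_mul hgn hH'n (norm_nonneg _) (by positivity))
    refine (norm_add_le _ _).trans ((add_le_add h1 h2).trans (le_of_eq ?_))
    ring
  have hHpos : 0 < ‖H‖ := norm_pos_iff.2 hH
  have h3 := mul_le_mul_of_nonneg_left hPH (norm_nonneg w)
  refine le_of_mul_le_mul_right ?_ hHpos
  linarith

end EigenvalueEstimate

/-! ### Continuity of polynomial roots. -/

section Roots

open Polynomial

open Classical in
/-- Continuity of the roots of a polynomial, counted with multiplicity. -/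
lemma exists_eventually_card_filter_roots {ι : Type*} {l : Filter ι} {p : ι → ℂ[X]} {p₀ : ℂ[X]}
    {d : ℕ} (hp : ∀ i, (p i).Monic) (hd : ∀ i, (p i).natDegree = d)
    (hlim : ∀ x, Tendsto (fun i => (p i).eval x) l (𝓝 (p₀.eval x)))
    {R : ℝ} (hR : ∀ᶠ i in l, ∀ z ∈ (p i).roots, ‖z‖ ≤ R) (a : ℂ) :
    ∃ r₀ > 0, ∀ r, 0 < r → r ≤ r₀ → ∀ᶠ i in l,
      ((p i).roots.filter (fun z => dist z a < r)).card = p₀.rootMultiplicity a := by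
  obtain ⟨δ, hδ, hsep⟩ : ∃ δ > 0, ∀ z ∈ p₀.roots, z ≠ a → δ ≤ dist z a := by
    have hfin : ({z | z ∈ p₀.roots} \ {a} : Set ℂ).Finite :=
      (p₀.roots.toFinset.finite_toSet.subset (fun z hz => by simpa using hz)).sdiff
    obtain ⟨δ, hδ, hball⟩ := Metric.mem_nhds_iff.1
      (hfin.isClosed.isOpen_compl.mem_nhds (show a ∈ ({z | z ∈ p₀.roots} \ {a} : Set ℂ)ᶜ from
        fun h => h.2 rfl))
    refine ⟨δ, hδ, fun z hz hza => ?_⟩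
    by_contra! hlt
    exact hball (Metric.mem_ball.2 hlt) ⟨hz, hza⟩
  -- Half of δ keeps the other roots of p₀ at distance strictly greater than r.
  refine ⟨δ / 2, half_pos hδ, fun r hr hrδ => ?_⟩
  by_contra hev
  have hfreq : ∃ᶠ i in l,
      ((p i).roots.filter (fun z => dist z a < r)).card ≠ p₀.rootMultiplicity a :=
    Filter.not_eventually.1 hev
  have hne := Filter.frequently_iff_neBot.1 hfreq
  -- Along an ultrafilter on which the count is wrong, the enumerated roots converge by compactness;
  -- their limits are the roots of p₀, which contradicts the wrong count.
  set U : Ultrafilter ι := @Ultrafilter.of _ _ hne with hU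
  have hUl : (U : Filter ι) ≤ l := (@Ultrafilter.of_le _ _ hne).trans inf_le_left
  have hUs : ∀ᶠ i in (U : Filter ι),
      ((p i).roots.filter (fun z => dist z a < r)).card ≠ p₀.rootMultiplicity a :=
    (@Ultrafilter.of_le _ _ hne).trans inf_le_right (mem_principal_self _)
  have henum : ∀ i, ∃ z : Fin d → ℂ, (p i).roots = Finset.univ.val.map z := fun i => by
    have hc : (p i).roots.card = d := by
      rw [← hd i]; exact splits_iff_card_roots.1 (IsAlgClosed.splits _)
    obtain ⟨L, hL⟩ := Quot.exists_rep (p i).roots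
    have hlen : L.length = d := by rw [← hc, ← hL]; rfl
    subst hlen
    exact ⟨L.get, by rw [Fin.univ_val_map, List.ofFn_get]; exact hL.symm⟩
  choose z hz using henum
  obtain ⟨w, -, hw⟩ := (isCompact_closedBall (0 : Fin d → ℂ) |R|).ultrafilter_le_nhds'
    (U.map z) (by
      have : ∀ᶠ i in (U : Filter ι), z i ∈ Metric.closedBall (0 : Fin d → ℂ) |R| := by
        filter_upwards [hUl hR] with i hi
        rw [mem_closedBall_zero_iff, pi_norm_le_iff_of_nonneg (abs_nonneg R)]
        exact fun j => (hi _ (by rw [hz]; simp)).trans (le_abs_self R)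
      exact this)
  have hwt : Tendsto z U (𝓝 w) := hw
  have hprod : ∀ i, p i = (Finset.univ.val.map fun j => X - C (z i j)).prod := fun i => by
    have := (IsAlgClosed.splits (p i)).eq_prod_roots_of_monic (hp i)
    rw [hz, Multiset.map_map] at this
    exact this
  have hp₀w : p₀ = (Finset.univ.val.map fun j => X - C (w j)).prod := by
    refine Polynomial.funext fun x => ?_
    have h1 : Tendsto (fun i => (p i).eval x) U (𝓝 (p₀.eval x)) := (hlim x).mono_left hUl
    have h2 : Tendsto (fun i => ∏ j, (x - z i j)) U (𝓝 (∏ j, (x - w j))) :=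
      tendsto_finsetProd _ fun j _ => tendsto_const_nhds.sub ((tendsto_pi_nhds.1 hwt) j)
    have h3 : ∀ i, (p i).eval x = ∏ j, (x - z i j) := fun i => by
      rw [hprod i]
      change eval x (∏ j, (X - C (z i j))) = _
      simp only [eval_prod, eval_sub, eval_X, eval_C]
    simp only [h3] at h1
    rw [tendsto_nhds_unique h1 h2]
    change _ = eval x (∏ j, (X - C (w j)))
    simp [eval_prod]
  have hroots : p₀.roots = Finset.univ.val.map w := by
    have := roots_multiset_prod_X_sub_C (Finset.univ.val.map w)
    rwa [Multiset.map_map, Function.comp_def, ← hp₀w] at this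
  have hmult : p₀.rootMultiplicity a = (Finset.univ.val.filter fun j => w j = a).card := by
    rw [← count_roots, hroots, Multiset.count_map]
    simp only [eq_comm]
  have hiff : ∀ᶠ i in (U : Filter ι), ∀ j, dist (z i j) a < r ↔ w j = a := by
    refine Filter.eventually_all.2 fun j => ?_
    have hj := (tendsto_pi_nhds.1 hwt) j
    by_cases hja : w j = a
    · rw [hja] at hj
      filter_upwards [hj (Metric.ball_mem_nhds a hr)] with i hi
      simpa [hja] using hi
    · have hlt : r < dist (w j) a := by
        have := hsep (w j) (by rw [hroots]; simp) hja
        linarith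
      filter_upwards [(hj.dist tendsto_const_nhds).eventually (lt_mem_nhds hlt)] with i hi
      simp [hja, hi.le]
  obtain ⟨i, hi, hne⟩ := (hiff.and hUs).exists
  refine hne ?_
  rw [hmult, hz, Multiset.filter_map, Multiset.card_map]
  congr 1
  exact Multiset.filter_congr fun j _ => hi j

end Roots

/-! ### Common eigenvectors of commuting operators. -/

section CommonEigenvector

variable {V : Type*} [AddCommGroup V] [Module ℂ V] [FiniteDimensional ℂ V]

lemma exists_eigenvector_mem {U : Submodule ℂ V} (hU : U ≠ ⊥) {f : Module.End ℂ V}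
    (hf : ∀ v ∈ U, f v ∈ U) : ∃ x : ℂ, ∃ v ∈ U, v ≠ 0 ∧ f v = x • v := by
  have : Nontrivial U := Submodule.nontrivial_iff_ne_bot.2 hU
  obtain ⟨x, hx⟩ := Module.End.exists_eigenvalue (f.restrict hf)
  obtain ⟨v, hv⟩ := hx.exists_hasEigenvector
  refine ⟨x, v, v.2, fun h => hv.2 (Subtype.ext h), ?_⟩
  simpa using congrArg Subtype.val hv.apply_eq_smul

lemma exists_common_eigenvector_mem {U : Submodule ℂ V} (hU : U ≠ ⊥) {f g : Module.End ℂ V}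
    (hf : ∀ v ∈ U, f v ∈ U) (hg : ∀ v ∈ U, g v ∈ U) (hfg : ∀ v, f (g v) = g (f v)) :
    ∃ x y : ℂ, ∃ v ∈ U, v ≠ 0 ∧ f v = x • v ∧ g v = y • v := by
  obtain ⟨x, v, hvU, hv0, hv⟩ := exists_eigenvector_mem hU hf
  have hU' : U ⊓ f.eigenspace x ≠ ⊥ :=
    (Submodule.ne_bot_iff _).2 ⟨v, ⟨hvU, Module.End.mem_eigenspace_iff.2 hv⟩, hv0⟩
  obtain ⟨y, w, hwU, hw0, hw⟩ := exists_eigenvector_mem hU' (f := g) fun w hw =>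
    ⟨hg w hw.1, Module.End.mem_eigenspace_iff.2 (by
      rw [hfg, Module.End.mem_eigenspace_iff.1 hw.2, map_smul])⟩
  exact ⟨x, y, w, hwU.1, hw0, Module.End.mem_eigenspace_iff.1 hwU.2, hw⟩

end CommonEigenvector

/-! ### Spectra, folding and eigenprojections of matrices. -/

section Matrices

variable {n : Type*} [Fintype n] [DecidableEq n]

lemma matrix_exp_smul_one (z : ℂ) :
    NormedSpace.exp (z • (1 : Matrix n n ℂ)) = Complex.exp z • (1 : Matrix n n ℂ) := by
  rw [Complex.exp_eq_exp_ℂ, ← Algebra.algebraMap_eq_smul_one, ← Algebra.algebraMap_eq_smul_one]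
  open scoped Matrix.Norms.Operator in
  exact (NormedSpace.algebraMap_exp_comm (𝕂 := ℂ) (𝔸 := Matrix n n ℂ) z).symm

lemma matrix_exp_smul_mul_eq_mul_exp_smul {a b h : Matrix n n ℂ} (H : a * h = h * b) (t : ℝ) :
    NormedSpace.exp (t • a) * h = h * NormedSpace.exp (t • b) :=
  open scoped Matrix.Norms.Operator in exp_smul_mul_eq_mul_exp_smul H t

lemma matrix_exp_mul_eq_mul_exp {a b h : Matrix n n ℂ} (H : a * h = h * b) :
    NormedSpace.exp a * h = h * NormedSpace.exp b :=
  open scoped Matrix.Norms.Operator in exp_mul_eq_mul_exp H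

lemma matrix_exp_smul_mul_exp_smul_neg (a : Matrix n n ℂ) (t : ℝ) :
    NormedSpace.exp (t • a) * NormedSpace.exp (t • -a) = 1 :=
  open scoped Matrix.Norms.Operator in exp_smul_mul_exp_smul_neg a t

lemma matrix_exp_mul_mul_exp_neg_of_nilpotent {a b h k : Matrix n n ℂ} (hk : a * h - h * b = k)
    (H : a * k = k * b) : NormedSpace.exp a * h * NormedSpace.exp (-b) = h + k :=
  open scoped Matrix.Norms.Operator in exp_mul_mul_exp_neg_of_nilpotent hk H

lemma mem_spectrum_of_mul_eq_smul {F H : Matrix n n ℂ} {z : ℂ} (hH : H ≠ 0) (h : F * H = z • H) :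
    z ∈ spectrum ℂ F := by
  refine spectrum.mem_iff.2 fun hu => hH (hu.mul_right_eq_zero.1 ?_)
  rw [sub_mul, h, Algebra.algebraMap_eq_smul_one, smul_mul_assoc, one_mul, sub_self]

lemma mem_spectrum_of_mul_eq_smul' {F H : Matrix n n ℂ} {z : ℂ} (hH : H ≠ 0) (h : H * F = z • H) :
    z ∈ spectrum ℂ F := by
  refine spectrum.mem_iff.2 fun hu => hH (hu.mul_left_eq_zero.1 ?_)
  rw [mul_sub, h, Algebra.algebraMap_eq_smul_one, mul_smul_comm, mul_one, sub_self]

/-- If the exponential is injective on the spectra of `F` and `B`, then whatever intertwines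
`exp F` and `exp B` intertwines `F` and `B`. -/
lemma mul_eq_mul_of_exp_mul_eq_mul_exp {F B H : Matrix n n ℂ}
    (hs : ∀ f ∈ spectrum ℂ F, ∀ b ∈ spectrum ℂ B, Complex.exp f = Complex.exp b → f = b)
    (h : NormedSpace.exp F * H = H * NormedSpace.exp B) : F * H = H * B := by
  set f : Module.End ℂ (Matrix n n ℂ) := LinearMap.mulLeft ℂ F with hf
  set g : Module.End ℂ (Matrix n n ℂ) := LinearMap.mulRight ℂ B with hg
  have hfa : ∀ G, f G = F * G := fun _ => rfl
  have hga : ∀ G, g G = G * B := fun _ => rfl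
  set W : Submodule ℂ (Matrix n n ℂ) := LinearMap.ker (LinearMap.mulLeft ℂ (NormedSpace.exp F) -
    LinearMap.mulRight ℂ (NormedSpace.exp B)) with hW
  have hmem : ∀ G, G ∈ W ↔ NormedSpace.exp F * G = G * NormedSpace.exp B := fun G => by
    rw [hW, LinearMap.mem_ker]
    simp [sub_eq_zero]
  have hcF : Commute F (NormedSpace.exp F) := (Commute.refl F).exp_right
  have hcB : Commute B (NormedSpace.exp B) := (Commute.refl B).exp_right
  have hWf : ∀ G ∈ W, f G ∈ W := fun G hG => by
    rw [hmem] at hG ⊢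
    rw [hfa, ← mul_assoc, ← hcF.eq, mul_assoc, hG, mul_assoc]
  have hWg : ∀ G ∈ W, g G ∈ W := fun G hG => by
    rw [hmem] at hG ⊢
    rw [hga, ← mul_assoc, hG, mul_assoc, mul_assoc, hcB.eq]
  have hfg : ∀ G, f (g G) = g (f G) := fun G => by simp only [hfa, hga, mul_assoc]
  -- Otherwise the image of W under f - g contains a common eigenvector k = F G - G B of the
  -- commuting operators f and g.
  by_contra hne
  have hU : W.map (f - g) ≠ ⊥ := (Submodule.ne_bot_iff _).2
    ⟨_, ⟨H, (hmem H).2 h, rfl⟩, by simpa [hfa, hga, sub_eq_zero] using hne⟩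
  have hUf : ∀ G ∈ W.map (f - g), f G ∈ W.map (f - g) := by
    rintro _ ⟨G, hG, rfl⟩
    exact ⟨f G, hWf G hG, by simp [hfg]⟩
  have hUg : ∀ G ∈ W.map (f - g), g G ∈ W.map (f - g) := by
    rintro _ ⟨G, hG, rfl⟩
    exact ⟨g G, hWg G hG, by simp [hfg]⟩
  obtain ⟨x, y, k, ⟨G, hG, hGk⟩, hk0, hkx, hky⟩ := exists_common_eigenvector_mem hU hUf hUg hfg
  have hkW : k ∈ W := by
    rw [← hGk]
    exact W.sub_mem (hWf G hG) (hWg G hG)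
  rw [hfa] at hkx
  rw [hga] at hky
  -- Since k lies in W, its two eigenvalues have equal exponentials, hence are equal, so F k = k B.
  -- Then e^F G e^{-B} is G + k, yet it is G because G lies in W; so k = 0.
  have hexp : Complex.exp x = Complex.exp y := by
    have h1 : NormedSpace.exp F * k = Complex.exp x • k := by
      have := matrix_exp_mul_eq_mul_exp (a := F) (h := k) (b := x • 1) (by simpa using hkx)
      rw [this, matrix_exp_smul_one]; simp
    have h2 : k * NormedSpace.exp B = Complex.exp y • k := by
      have := matrix_exp_mul_eq_mul_exp (a := y • 1) (h := k) (b := B) (by simpa using hky.symm)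
      rw [← this, matrix_exp_smul_one]; simp
    have h3 := (hmem k).1 hkW
    rw [h1, h2] at h3
    exact smul_left_injective ℂ hk0 h3
  have hxy := hs x (mem_spectrum_of_mul_eq_smul hk0 hkx) y
    (mem_spectrum_of_mul_eq_smul' hk0 hky) hexp
  have hFk : F * k = k * B := by rw [hkx, hky, hxy]
  have h4 := matrix_exp_mul_mul_exp_neg_of_nilpotent (a := F) (b := B) (h := G) (k := k) hGk hFk
  have hinv : NormedSpace.exp B * NormedSpace.exp (-B) = 1 := by
    simpa using matrix_exp_smul_mul_exp_smul_neg B 1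
  rw [(hmem G).1 hG, mul_assoc, hinv, mul_one] at h4
  exact hk0 (by simpa using h4.symm)

lemma isFolded_iff {Ω : ℝ} {F : Matrix n n ℂ} :
    IsFolded Ω F ↔ ∀ z ∈ spectrum ℂ F, z.im ∈ Set.Ico (-(Ω / 2)) (Ω / 2) := by
  simp only [IsFolded, Polynomial.mem_roots F.charpoly_monic.ne_zero,
    Matrix.mem_spectrum_iff_isRoot_charpoly]

/-- The two numbers differ by an integer multiple of iΩ, and the strip, half-open of height Ω,
leaves only the multiple zero. -/
lemma eq_of_exp_period_mul_eq {Ω : ℝ} (hΩ : 0 < Ω) {x y : ℂ}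
    (hx : x.im ∈ Set.Ico (-(Ω / 2)) (Ω / 2)) (hy : y.im ∈ Set.Ico (-(Ω / 2)) (Ω / 2))
    (h : Complex.exp ((2 * Real.pi / Ω : ℝ) * x) = Complex.exp ((2 * Real.pi / Ω : ℝ) * y)) :
    x = y := by
  obtain ⟨k, hk⟩ := Complex.exp_eq_exp_iff_exists_int.1 h
  have hΩ' : (Ω : ℂ) ≠ 0 := by exact_mod_cast hΩ.ne'
  have hpi : (Real.pi : ℂ) ≠ 0 := by exact_mod_cast Real.pi_ne_zero
  have hxy : x = y + k * Ω * Complex.I := by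
    push_cast at hk
    field_simp at hk
    linear_combination hk
  have him : x.im = y.im + k * Ω := by rw [hxy]; simp
  have hk0 : k = 0 := by
    have h1 : (k : ℝ) * Ω < 1 * Ω := by linarith [hx.1, hx.2, hy.1, hy.2]
    have h2 : (-1 : ℝ) * Ω < k * Ω := by linarith [hx.1, hx.2, hy.1, hy.2]
    have h3 : (k : ℝ) < 1 := lt_of_mul_lt_mul_right h1 hΩ.le
    have h4 : (-1 : ℝ) < k := lt_of_mul_lt_mul_right h2 hΩ.le
    have h5 : k < 1 := by exact_mod_cast h3
    have h6 : -1 < k := by exact_mod_cast h4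
    omega
  simpa [hk0] using hxy

lemma mem_spectrum_smul {T : ℝ} (hT : T ≠ 0) {F : Matrix n n ℂ} {z : ℂ}
    (hz : z ∈ spectrum ℂ (T • F)) : ∃ f ∈ spectrum ℂ F, z = (T : ℂ) * f := by
  have hT' : (T : ℂ) ≠ 0 := by exact_mod_cast hT
  have hTF : T • F = Units.mk0 (T : ℂ) hT' • F := by
    ext i j
    simp [Units.smul_def]
  rw [hTF, spectrum.unit_smul_eq_smul] at hz
  obtain ⟨f, hf, rfl⟩ := hz
  exact ⟨f, hf, rfl⟩

/-- Used with B = F for the commutant of the monodromy matrix, and with B scalar for its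
eigenvectors. -/
lemma IsFolded.mul_eq_mul {Ω : ℝ} (hΩ : 0 < Ω) {F B H : Matrix n n ℂ} (hF : IsFolded Ω F)
    (hB : IsFolded Ω B) (h : NormedSpace.exp ((2 * Real.pi / Ω : ℝ) • F) * H =
      H * NormedSpace.exp ((2 * Real.pi / Ω : ℝ) • B)) : F * H = H * B := by
  have hT : (2 * Real.pi / Ω : ℝ) ≠ 0 := by positivity
  have h1 := mul_eq_mul_of_exp_mul_eq_mul_exp (fun f hf b hb hfb => by
    obtain ⟨f, hf', rfl⟩ := mem_spectrum_smul hT hf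
    obtain ⟨b, hb', rfl⟩ := mem_spectrum_smul hT hb
    rw [eq_of_exp_period_mul_eq hΩ (isFolded_iff.1 hF f hf') (isFolded_iff.1 hB b hb') hfb]) h
  rw [smul_mul_assoc, mul_smul_comm] at h1
  exact smul_right_injective _ hT h1

lemma isFolded_smul_one {Ω : ℝ} {z : ℂ} (hz : z.im ∈ Set.Ico (-(Ω / 2)) (Ω / 2)) :
    IsFolded Ω (z • (1 : Matrix n n ℂ)) := by
  refine isFolded_iff.2 fun w hw => ?_
  suffices w = z from this ▸ hz
  by_contra hne
  refine spectrum.mem_iff.1 hw ?_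
  rw [Algebra.algebraMap_eq_smul_one, ← sub_smul]
  exact (isUnit_one).smul (Units.mk0 (w - z) (sub_ne_zero.2 hne))

/-- Repeating an eigenvector in every column keeps the eigenvalue estimate inside the matrix
algebra. -/
lemma exists_mul_eq_smul_of_mem_roots {F : Matrix n n ℂ} {z : ℂ} (hz : z ∈ F.charpoly.roots) :
    ∃ H : Matrix n n ℂ, H ≠ 0 ∧ F * H = z • H := by
  have h1 : (Matrix.scalar n z - F).det = 0 := by
    rw [← Matrix.eval_charpoly]
    exact (Polynomial.mem_roots'.1 hz).2
  obtain ⟨v, hv0, hv⟩ := Matrix.exists_mulVec_eq_zero_iff.2 h1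
  obtain ⟨i, hi⟩ := Function.ne_iff.1 hv0
  refine ⟨Matrix.replicateCol n v, fun h => hi (by simpa using congrFun (congrFun h i) i), ?_⟩
  have h2 : F.mulVec v = z • v := by
    rw [Matrix.sub_mulVec, sub_eq_zero] at hv
    rw [← hv]
    ext i
    simp [Matrix.mulVec_diagonal]
  rw [← Matrix.replicateCol_mulVec, h2]
  rfl

lemma mulVec_eq_smul_iff {F : Matrix n n ℂ} {z : ℂ} {v : n → ℂ} :
    F.mulVec v = z • v ↔ F * Matrix.replicateCol n v = Matrix.replicateCol n v * z • 1 := by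
  rw [← Matrix.replicateCol_mulVec, mul_smul_comm, mul_one]
  constructor
  · intro h; rw [h]; rfl
  · intro h
    ext i
    simpa using congrFun (congrFun h i) i

lemma mem_eigSpace {F : Matrix n n ℂ} {z : ℂ} {v : n → ℂ} :
    v ∈ eigSpace F z ↔ F.mulVec v = z • v := by
  simp [eigSpace]

lemma finrank_eigSpace_le (F : Matrix n n ℂ) (z : ℂ) :
    Module.finrank ℂ (eigSpace F z) ≤ F.charpoly.rootMultiplicity z := by
  have := LinearMap.finrank_eigenspace_le (Matrix.toLin' F) z
  rwa [Matrix.charpoly_toLin'] at this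

lemma eigSpace_eq_ker (F : Matrix n n ℂ) (z : ℂ) :
    eigSpace F z = LinearMap.ker (Matrix.toLin' (F - z • 1)) := by
  rw [map_sub, map_smul, Matrix.toLin'_one, eigSpace, Module.End.eigenspace_def]
  rfl

lemma toLin'_eq_self_of_mem_range {P : Matrix n n ℂ} (hP : P * P = P) {v : n → ℂ}
    (hv : v ∈ LinearMap.range (Matrix.toLin' P)) : P.mulVec v = v := by
  obtain ⟨w, rfl⟩ := hv
  rw [Matrix.toLin'_apply, Matrix.mulVec_mulVec, hP]

lemma IsEigenprojection.mulVec_mem {F P : Matrix n n ℂ} {z : ℂ} (h : IsEigenprojection F z P)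
    (v : n → ℂ) : P.mulVec v ∈ eigSpace F z := by
  rw [← h.2.1]
  exact ⟨v, rfl⟩

lemma IsEigenprojection.mulVec_eq_self {F P : Matrix n n ℂ} {z : ℂ} (h : IsEigenprojection F z P)
    {v : n → ℂ} (hv : v ∈ eigSpace F z) : P.mulVec v = v :=
  toLin'_eq_self_of_mem_range h.1 (by rwa [h.2.1])

lemma mul_eq_smul_of_forall_mulVec_mem {F P : Matrix n n ℂ} {z : ℂ}
    (h : ∀ v, P.mulVec v ∈ eigSpace F z) : F * P = z • P := by
  refine Matrix.ext_of_mulVec_single fun i => ?_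
  rw [← Matrix.mulVec_mulVec, mem_eigSpace.1 (h _), Matrix.smul_mulVec]

lemma IsEigenprojection.mul_eq_smul {F P : Matrix n n ℂ} {z : ℂ} (h : IsEigenprojection F z P) :
    F * P = z • P :=
  mul_eq_smul_of_forall_mulVec_mem h.mulVec_mem

lemma IsEigenprojection.mulVec_sub {F P : Matrix n n ℂ} {z : ℂ} (h : IsEigenprojection F z P)
    (v : n → ℂ) : P.mulVec ((F - z • 1).mulVec v) = 0 := by
  have : Matrix.toLin' (F - z • 1) v ∈ LinearMap.ker (Matrix.toLin' P) := by
    rw [h.2.2]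
    exact ⟨v, rfl⟩
  exact this

lemma IsEigenprojection.mul_sub_eq_zero {F P : Matrix n n ℂ} {z : ℂ}
    (h : IsEigenprojection F z P) : P * (F - z • 1) = 0 := by
  refine Matrix.ext_of_mulVec_single fun i => ?_
  rw [← Matrix.mulVec_mulVec, h.mulVec_sub, Matrix.zero_mulVec]

lemma IsEigenprojection.mul_eq_smul' {F P : Matrix n n ℂ} {z : ℂ} (h : IsEigenprojection F z P) :
    P * F = z • P := by
  simpa [mul_sub, sub_eq_zero] using h.mul_sub_eq_zero

/-- A matrix commuting with F preserves the eigenspace and the range of F - z, which are the range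
and kernel of P. -/
lemma IsEigenprojection.commute {F P A : Matrix n n ℂ} {z : ℂ} (h : IsEigenprojection F z P)
    (hA : F * A = A * F) : A * P = P * A := by
  refine Matrix.ext_of_mulVec_single fun i => ?_
  set v : n → ℂ := Pi.single i 1
  have h1 : P.mulVec (A.mulVec (P.mulVec v)) = A.mulVec (P.mulVec v) := by
    refine h.mulVec_eq_self (mem_eigSpace.2 ?_)
    rw [Matrix.mulVec_mulVec, hA, ← Matrix.mulVec_mulVec, mem_eigSpace.1 (h.mulVec_mem v),
      Matrix.mulVec_smul]
  have h2 : v - P.mulVec v ∈ LinearMap.ker (Matrix.toLin' P) := by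
    simp [Matrix.mulVec_sub, h.1]
  rw [h.2.2] at h2
  obtain ⟨w, hw⟩ := h2
  rw [Matrix.toLin'_apply] at hw
  have hA' : A * (F - z • 1) = (F - z • 1) * A := by simp [mul_sub, sub_mul, hA]
  have h3 : P.mulVec (A.mulVec (v - P.mulVec v)) = 0 := by
    rw [← hw, Matrix.mulVec_mulVec _ A, hA', ← Matrix.mulVec_mulVec, h.mulVec_sub]
  rw [Matrix.mulVec_sub, Matrix.mulVec_sub, h1, sub_eq_zero] at h3
  rw [← Matrix.mulVec_mulVec, ← Matrix.mulVec_mulVec, h3]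

/-- S is the inverse of F - z + P. That matrix fixes P from the left, hence so does S. -/
lemma IsEigenprojection.exists_reducedResolvent {F P : Matrix n n ℂ} {z : ℂ}
    (h : IsEigenprojection F z P) : ∃ S : Matrix n n ℂ, S * (F - z • 1) = 1 - P := by
  have hG : IsUnit (F - z • 1 + P) := by
    rw [← Matrix.mulVec_injective_iff_isUnit]
    refine (injective_iff_map_eq_zero (Matrix.mulVecLin (F - z • 1 + P))).2 fun v hv => ?_
    rw [Matrix.mulVecLin_apply, Matrix.add_mulVec] at hv
    have h1 := congrArg P.mulVec hv
    rw [Matrix.mulVec_add, h.mulVec_sub, zero_add, Matrix.mulVec_mulVec, h.1,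
      Matrix.mulVec_zero] at h1
    rw [h1, add_zero] at hv
    rw [← h1, h.mulVec_eq_self]
    rw [eigSpace_eq_ker]
    exact hv
  obtain ⟨S, hS⟩ := hG.exists_left_inv
  refine ⟨S, ?_⟩
  have h1 : (F - z • 1 + P) * P = P := by
    simp [add_mul, sub_mul, h.mul_eq_smul, h.1]
  have h2 : S * P = P := by
    conv_lhs => rw [← h1, ← mul_assoc, hS, one_mul]
  rw [mul_add, h2] at hS
  exact eq_sub_of_add_eq hS

/-- A semisimple eigenvalue has an eigenprojection. -/
lemma exists_isEigenprojection {F : Matrix n n ℂ} {z : ℂ}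
    (h : Module.finrank ℂ (eigSpace F z) = F.charpoly.rootMultiplicity z) :
    ∃ P : Matrix n n ℂ, IsEigenprojection F z P := by
  set g := Matrix.toLin' (F - z • 1) with hg
  have hgf : g = Matrix.toLin' F - z • 1 := by
    rw [hg, map_sub, map_smul, Matrix.toLin'_one]; rfl
  have hker : LinearMap.ker g = eigSpace F z := (eigSpace_eq_ker F z).symm
  -- With no generalised eigenvectors, (F - z)² y = 0 forces (F - z) y = 0, so kernel and range of F
  -- - z meet trivially.
  have hmax : Module.End.maxGenEigenspace (Matrix.toLin' F) z = eigSpace F z := by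
    symm
    refine Submodule.eq_of_le_of_finrank_eq
      ((Module.End.genEigenspace _ _).mono le_top) ?_
    rw [h, LinearMap.finrank_maxGenEigenspace_eq, Matrix.charpoly_toLin']
  have hdisj : Disjoint (LinearMap.ker g) (LinearMap.range g) := by
    refine Submodule.disjoint_def.2 fun x hx hx' => ?_
    obtain ⟨y, rfl⟩ := hx'
    have hy : y ∈ Module.End.maxGenEigenspace (Matrix.toLin' F) z := by
      refine (Module.End.mem_maxGenEigenspace _ _ _).2 ⟨2, ?_⟩
      rw [← hgf, pow_two]
      exact hx
    rw [hmax, ← hker] at hy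
    exact hy
  have hcompl : IsCompl (LinearMap.ker g) (LinearMap.range g) :=
    (Submodule.isCompl_iff_disjoint _ _ (by
      rw [add_comm, LinearMap.finrank_range_add_finrank_ker])).2 hdisj
  set P := LinearMap.toMatrix' ((LinearMap.ker g).projection (LinearMap.range g) hcompl) with hP
  have hPl : Matrix.toLin' P = (LinearMap.ker g).projection (LinearMap.range g) hcompl :=
    Matrix.toLin'_toMatrix' _
  refine ⟨P, ?_, ?_, ?_⟩
  · apply Matrix.toLin'.injective
    rw [Matrix.toLin'_mul, hPl]
    exact Submodule.isIdempotentElem_projection hcompl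
  · rw [hPl, Submodule.range_projection, hker]
  · rw [hPl, Submodule.ker_projection]

end Matrices

/-! ### Expansion of a continuous family of Floquet matrices. -/

section FloquetExpansion

open NormedSpace

variable {𝔸 : Type*} [NormedRing 𝔸] [NormedAlgebra ℝ 𝔸] [CompleteSpace 𝔸]

/-- First-order expansion of a continuous family of Floquet matrices. -/
lemma exists_isBigO_floquet [FiniteDimensional ℝ 𝔸] {a : 𝔸} {a₁ : ℝ → 𝔸} (ha₁ : Continuous a₁)
    {A X : ℝ → ℝ → 𝔸} {F : ℝ → 𝔸} {T K : ℝ} (hT : 0 < T)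
    (hA : ∀ᶠ ε in 𝓝 (0 : ℝ), ∀ t ∈ Set.Icc 0 T, ‖A ε t - a - ε • a₁ t‖ ≤ K * ε ^ 2)
    (hX₀ : ∀ᶠ ε in 𝓝 (0 : ℝ), X ε 0 = 1)
    (hX : ∀ᶠ ε in 𝓝 (0 : ℝ), ∀ t, HasDerivAt (X ε) (A ε t * X ε t) t)
    (hXF : ∀ᶠ ε in 𝓝 (0 : ℝ), X ε T = exp (T • F ε)) (hF : ContinuousAt F 0)
    (hcomm : ∀ h, exp (T • F 0) * h = h * exp (T • F 0) → F 0 * h = h * F 0) :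
    exp (T • F 0) = exp (T • a) ∧
    ∃ F₁ : 𝔸, (fun ε => F ε - F 0 - ε • F₁) =O[𝓝 0] (fun ε : ℝ => ε ^ 2) ∧
      ∀ P m m' : 𝔸, (∀ x, m * x = x * m) → a * P = P * m → P * a = m * P →
        (∀ x, m' * x = x * m') → F 0 * P = P * m' → P * F 0 = m' * P →
        P * (∫ t in (0 : ℝ)..T, a₁ t) = 0 → P * F₁ * P = 0 := by
  set Ia := ∫ s in (0 : ℝ)..T, exp (s • -a) * a₁ s * exp (s • a) with hIa
  have hexp : (fun ε => exp (T • F ε) - exp (T • a) * (1 + ε • Ia)) =O[𝓝 0]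
      fun ε : ℝ => ε ^ 2 :=
    (isBigO_fundamentalSolution ha₁ hT.le hA hX₀ hX).congr' (by
      filter_upwards [hXF] with ε hε
      rw [hε]) EventuallyEq.rfl
  -- At ε = 0 itself the quadratic bound is an equality.
  have h0 : exp (T • F 0) = exp (T • a) := by
    obtain ⟨C, hC⟩ := hexp.bound
    simpa [sub_eq_zero] using hC.self_of_nhds
  refine ⟨h0, ?_⟩
  have hlin : (fun ε => exp (T • F ε) - exp (T • F 0) - ε • (exp (T • a) * Ia)) =O[𝓝 0]
      fun ε : ℝ => ε ^ 2 := hexp.congr_left fun ε => by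
    rw [h0, mul_add, mul_one, mul_smul_comm, sub_sub]
  have hinj : Function.Injective (fderiv ℝ (exp : 𝔸 → 𝔸) (T • F 0)) :=
    fderiv_exp_injective fun h hh => by
      rw [smul_mul_assoc, mul_smul_comm, hcomm h hh]
  obtain ⟨u₁, hu₁⟩ := exists_isBigO_of_injective hinj (isBigO_exp_sub_fderiv (T • F 0))
    (u := fun ε => T • F ε) (hF.const_smul T) hlin
  have hF₁ : (fun ε => F ε - F 0 - ε • T⁻¹ • u₁) =O[𝓝 0] fun ε : ℝ => ε ^ 2 := by
    refine (hu₁.const_smul_left T⁻¹).congr_left fun ε => ?_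
    rw [Pi.smul_apply, smul_sub, smul_sub, inv_smul_smul₀ hT.ne', inv_smul_smul₀ hT.ne', smul_comm]
  refine ⟨T⁻¹ • u₁, hF₁, fun P m m' hm haP hPa hm' hFP hPF hint => ?_⟩
  set F₁ : 𝔸 := T⁻¹ • u₁ with hF₁def
  obtain ⟨C, hC⟩ := hF₁.bound
  -- The autonomous system with matrix F ε has the same value exp (T • F ε) at time T, so the two
  -- first-order terms agree.
  have hexp' := isBigO_fundamentalSolution (a := F 0) (a₁ := fun _ => F₁) continuous_const
    (A := fun ε _ => F ε) (X := fun ε t => exp (t • F ε)) (K := C) hT.le (by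
      filter_upwards [hC] with ε hε t _
      simpa using hε) (Eventually.of_forall fun ε => by simp)
    (Eventually.of_forall fun ε t => hasDerivAt_exp_smul_const' (F ε) t)
  set IF := ∫ s in (0 : ℝ)..T, exp (s • -F 0) * F₁ * exp (s • F 0) with hIF
  have hII : Ia = IF := by
    have h1 : exp (T • a) * (IF - Ia) = 0 := by
      refine eq_zero_of_smul_isBigO_sq ((hexp.sub hexp').congr_left fun ε => ?_)
      rw [h0, mul_sub, smul_sub]
      simp only [mul_add, mul_smul_comm]
      abel
    have h2 := congrArg (exp (T • -a) * ·) h1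
    simp only [← mul_assoc, exp_smul_neg_mul_exp_smul, one_mul, mul_zero] at h2
    exact (sub_eq_zero.1 h2).symm
  have h1 := mul_integral_exp_conj_mul hm haP hPa ha₁ T
  have h2 := mul_integral_exp_conj_mul hm' hFP hPF (continuous_const (y := F₁)) T
  rw [← hIa, hII, hint, zero_mul] at h1
  rw [← hIF, h1, intervalIntegral.integral_const, sub_zero, mul_smul_comm, smul_mul_assoc] at h2
  exact (smul_eq_zero.1 h2.symm).resolve_left hT.ne'

end FloquetExpansion

/-! ### The edge eigenvalue of a Floquet matrix and its splitting. -/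

section FloquetMatrices

variable {n : Type*} [Fintype n] [DecidableEq n]

/-- The periodic factor is the identity at 0, hence also at T. -/
lemma IsFloquetMatrix.exists_fundamentalSolution {A : ℝ → Matrix n n ℂ} {T : ℝ}
    {F : Matrix n n ℂ} (h : IsFloquetMatrix A T F) :
    ∃ X, IsFundamentalSolution A X ∧ X T = NormedSpace.exp (T • F) := by
  obtain ⟨X, Q, hX, hQ, hXQ⟩ := h
  have h0 : Q 0 = 1 := by
    have := hXQ 0
    rw [hX.1] at this
    simpa using this.symm
  have hT : Q T = 1 := by
    have := hQ 0
    rw [zero_add] at this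
    rw [this, h0]
  refine ⟨X, hX, ?_⟩
  rw [hXQ T, hT, one_mul]
  congr 1

open scoped Matrix.Norms.Operator

lemma hasDerivAt_matrix {X : ℝ → Matrix n n ℂ} {X' : Matrix n n ℂ} {t : ℝ} :
    HasDerivAt X X' t ↔ ∀ i j, HasDerivAt (fun s => X s i j) (X' i j) t := by
  constructor
  · intro h i j
    exact ((Matrix.entryLinearMap ℝ ℂ i j).toContinuousLinearMap.hasFDerivAt.comp_hasDerivAt t h)
  · intro h
    have h1 : HasDerivAt (fun s => ∑ i, ∑ j, X s i j • Matrix.single i j (1 : ℂ))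
        (∑ i, ∑ j, X' i j • Matrix.single i j (1 : ℂ)) t :=
      HasDerivAt.fun_sum fun i _ => HasDerivAt.fun_sum fun j _ => (h i j).smul_const _
    have h2 : ∀ Y : Matrix n n ℂ, ∑ i, ∑ j, Y i j • Matrix.single i j (1 : ℂ) = Y := fun Y => by
      conv_rhs => rw [Matrix.matrix_eq_sum_single Y]
      simp [Matrix.smul_single]
    simpa only [h2] using h1

lemma matrix_norm_le {Y : Matrix n n ℂ} {C : ℝ} (h : ∀ i j, ‖Y i j‖ ≤ C) (hC : 0 ≤ C) :
    ‖Y‖ ≤ Fintype.card n * C := by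
  rw [Matrix.linfty_opNorm_def]
  have : (Finset.univ.sup fun i => ∑ j, ‖Y i j‖₊) ≤ Fintype.card n * C.toNNReal := by
    refine Finset.sup_le fun i _ => ?_
    calc ∑ j, ‖Y i j‖₊ ≤ ∑ _j : n, C.toNNReal := Finset.sum_le_sum fun j _ => by
          rw [← NNReal.coe_le_coe, Real.coe_toNNReal _ hC]; exact h i j
      _ = _ := by simp
  calc _ ≤ (((Fintype.card n : ℝ≥0) * C.toNNReal : ℝ≥0) : ℝ) := by exact_mod_cast this
    _ = _ := by rw [NNReal.coe_mul, Real.coe_toNNReal _ hC, NNReal.coe_natCast]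

lemma matrix_integral_apply {Y : ℝ → Matrix n n ℂ} (hY : Continuous Y) (T : ℝ) (i j : n) :
    (∫ t in (0 : ℝ)..T, Y t) i j = ∫ t in (0 : ℝ)..T, Y t i j :=
  ((Matrix.entryLinearMap ℝ ℂ i j).toContinuousLinearMap.intervalIntegral_comp_comm
    (hY.intervalIntegrable 0 T)).symm

/-- The doubly degenerate edge eigenvalue of a Floquet matrix whose first-order forcing has
vanishing mean. -/
theorem floquet_edge_expansion {A : ℝ → ℝ → Matrix n n ℂ} {A₁ : ℝ → Matrix n n ℂ} {K Ω : ℝ}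
    (hΩ : 0 < Ω) (hK : 0 ≤ K) (hA₁ : ∀ i j, Continuous fun t => A₁ t i j)
    (hint : ∀ i j, ∫ t in (0 : ℝ)..(2 * Real.pi / Ω), A₁ t i j = 0) {a : Matrix n n ℂ}
    (hA : ∀ᶠ ε in 𝓝 (0 : ℝ), ∀ t i j, ‖A ε t i j - a i j - ε * A₁ t i j‖ ≤ K * ε ^ 2)
    {F : ℝ → Matrix n n ℂ}
    (hF : ∀ᶠ ε in 𝓝 (0 : ℝ), IsFloquetMatrix (A ε) (2 * Real.pi / Ω) (F ε))
    (hFc : ContinuousAt F 0) (hF₀ : IsFolded Ω (F 0)) {μ ν₀ : ℂ} {k : ℤ}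
    (hν₀ : μ = ν₀ + Complex.I * (k * Ω)) (hdim : 2 ≤ Module.finrank ℂ (eigSpace a μ))
    (hmult : (F 0).charpoly.rootMultiplicity ν₀ = 2) :
    Module.finrank ℂ (eigSpace (F 0) ν₀) = 2 ∧
    ∃ F₁ P S : Matrix n n ℂ, (fun ε => F ε - F 0 - ε • F₁) =O[𝓝 0] (fun ε : ℝ => ε ^ 2) ∧
      IsEigenprojection (F 0) ν₀ P ∧ S * (F 0 - ν₀ • 1) = 1 - P ∧ P * F₁ * P = 0 := by
  set T : ℝ := 2 * Real.pi / Ω with hTdef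
  have hT : 0 < T := by positivity
  have hA₁c : Continuous A₁ := continuous_matrix hA₁
  obtain ⟨X, hX⟩ := (hF.mono fun ε h => h.exists_fundamentalSolution).choice
  have hcomm : ∀ h, NormedSpace.exp (T • F 0) * h = h * NormedSpace.exp (T • F 0) →
      F 0 * h = h * F 0 := fun h hh => IsFolded.mul_eq_mul hΩ hF₀ hF₀ hh
  obtain ⟨hexp, F₁, hF₁, hPF₁⟩ := exists_isBigO_floquet (a := a) (A := A) (X := X) (F := F)
    (K := Fintype.card n * K) hA₁c hT
    (hA.mono fun ε h t _ => by
      refine (matrix_norm_le (C := K * ε ^ 2) (fun i j => ?_) (by positivity)).trans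
        (le_of_eq (by ring))
      simpa using h t i j)
    (hX.mono fun ε h => h.1.1) (hX.mono fun ε h t => hasDerivAt_matrix.2 (h.1.2 t))
    (hX.mono fun ε h => h.2) hFc hcomm
  replace hexp : NormedSpace.exp (T • F 0) = NormedSpace.exp (T • a) := hexp
  have hν₀mem : ν₀ ∈ (F 0).charpoly.roots := by
    rw [← Multiset.count_pos, Polynomial.count_roots, hmult]
    exact two_pos
  have hνfold : IsFolded Ω (ν₀ • (1 : Matrix n n ℂ)) := isFolded_smul_one (hF₀ ν₀ hν₀mem)
  have hμν : NormedSpace.exp (T • (μ • (1 : Matrix n n ℂ))) =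
      NormedSpace.exp (T • (ν₀ • (1 : Matrix n n ℂ))) := by
    have hsmul : ∀ z : ℂ, T • (z • (1 : Matrix n n ℂ)) = ((T : ℂ) * z) • 1 := fun z => by
      rw [mul_smul]; rfl
    rw [hsmul, hsmul, matrix_exp_smul_one, matrix_exp_smul_one]
    congr 1
    refine Complex.exp_eq_exp_iff_exists_int.2 ⟨k, ?_⟩
    have hΩ' : (Ω : ℂ) ≠ 0 := by exact_mod_cast hΩ.ne'
    rw [hν₀, hTdef]
    push_cast
    field_simp
  have hle : eigSpace a μ ≤ eigSpace (F 0) ν₀ := fun v hv => by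
    rw [mem_eigSpace, mulVec_eq_smul_iff] at hv ⊢
    refine IsFolded.mul_eq_mul hΩ hF₀ hνfold ?_
    rw [← hTdef, hexp, ← hμν]
    exact matrix_exp_smul_mul_eq_mul_exp_smul hv T
  -- The dimension is squeezed between that of the eigenspace of a at μ and the algebraic
  -- multiplicity.
  have hfin : Module.finrank ℂ (eigSpace (F 0) ν₀) = 2 :=
    le_antisymm (hmult ▸ finrank_eigSpace_le _ _) (hdim.trans (Submodule.finrank_mono hle))
  have heq : eigSpace a μ = eigSpace (F 0) ν₀ :=
    Submodule.eq_of_le_of_finrank_le hle (hfin.trans_le hdim)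
  obtain ⟨P, hP⟩ := exists_isEigenprojection (hfin.trans hmult.symm)
  obtain ⟨S, hS⟩ := hP.exists_reducedResolvent
  -- Commuting with e^{Ta} = e^{TF₀}, a commutes with F₀ and so with P; this supplies P a = μ P.
  have hFa : F 0 * a = a * F 0 := hcomm a (by
    rw [hexp]
    exact (matrix_exp_smul_mul_eq_mul_exp_smul (h := a) rfl T))
  have haP : a * P = μ • P := mul_eq_smul_of_forall_mulVec_mem fun v => heq ▸ hP.mulVec_mem v
  refine ⟨hfin, F₁, P, S, hF₁, hP, hS, ?_⟩
  have hzero : ∫ t in (0 : ℝ)..T, A₁ t = 0 := by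
    ext i j
    rw [matrix_integral_apply hA₁c, hint]
    rfl
  exact hPF₁ P (μ • 1) (ν₀ • 1) (by simp) (by simpa using haP)
    (by simpa [← hP.commute hFa] using haP) (by simp) (by simpa using hP.mul_eq_smul)
    (by simpa using hP.mul_eq_smul') (by rw [hzero, mul_zero])

open Classical in
/-- A semisimple double eigenvalue whose first-order perturbation vanishes splits into two
eigenvalues which differ from it at second order. -/
theorem exists_eigenvalue_splitting {F : ℝ → Matrix n n ℂ} {F₁ P S : Matrix n n ℂ} {ν₀ : ℂ}
    (hFc : ContinuousAt F 0)
    (hF₁ : (fun ε => F ε - F 0 - ε • F₁) =O[𝓝 0] (fun ε : ℝ => ε ^ 2))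
    (hP : IsEigenprojection (F 0) ν₀ P) (hS : S * (F 0 - ν₀ • 1) = 1 - P)
    (hPF₁ : P * F₁ * P = 0) (hmult : (F 0).charpoly.rootMultiplicity ν₀ = 2) :
    ∃ νw νq : ℝ → ℂ,
      (∃ r : ℝ, 0 < r ∧ ∀ᶠ ε in 𝓝 (0 : ℝ), ∃ S : Multiset ℂ,
        (F ε).charpoly.roots = {νw ε, νq ε} + S ∧ ∀ z ∈ S, r ≤ dist z ν₀) ∧
      ((fun ε => νw ε - ν₀) =O[𝓝 0] fun ε : ℝ => ε ^ 2) ∧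
      ((fun ε => νq ε - ν₀) =O[𝓝 0] fun ε : ℝ => ε ^ 2) := by
  obtain ⟨r₁, hr₁, K, hK⟩ := exists_norm_eigenvalue_sub_le hP.1 hP.mul_eq_smul hP.mul_eq_smul' hS
    hPF₁ hF₁
  obtain ⟨r₀, hr₀, hcard⟩ := exists_eventually_card_filter_roots (l := 𝓝 (0 : ℝ))
    (p := fun ε => (F ε).charpoly) (p₀ := (F 0).charpoly) (d := Fintype.card n)
    (fun ε => Matrix.charpoly_monic _) (fun ε => Matrix.charpoly_natDegree_eq_dim _)
    (fun x => by
      simp only [Matrix.eval_charpoly]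
      have : Continuous fun Y : Matrix n n ℂ => (Matrix.scalar n x - Y).det :=
        (continuous_const.sub continuous_id).matrix_det
      exact (this.tendsto (F 0)).comp hFc)
    (R := (‖F 0‖ + 1) * ‖(1 : Matrix n n ℂ)‖) (by
      filter_upwards [hFc.norm.eventually (gt_mem_nhds (lt_add_one ‖F 0‖))] with ε hε z hz
      have hz' : z ∈ spectrum ℂ (F ε) :=
        Matrix.mem_spectrum_iff_isRoot_charpoly.2 (Polynomial.mem_roots'.1 hz).2
      exact (spectrum.norm_le_norm_mul_of_mem hz').trans
        (mul_le_mul_of_nonneg_right hε.le (norm_nonneg _))) ν₀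
  -- One radius for both the root count and the quadratic estimate.
  set r := min r₀ r₁ with hr
  have hr0 : 0 < r := lt_min hr₀ hr₁
  have hpair : ∀ᶠ ε in 𝓝 (0 : ℝ), ∃ p : ℂ × ℂ,
      (F ε).charpoly.roots.filter (fun z => dist z ν₀ < r) = {p.1, p.2} := by
    filter_upwards [hcard r hr0 (min_le_left _ _)] with ε hε
    rw [hmult] at hε
    obtain ⟨x, y, hxy⟩ := Multiset.card_eq_two.1 hε
    exact ⟨(x, y), hxy⟩
  obtain ⟨p, hp⟩ := hpair.choice
  have hbound : ∀ᶠ ε in 𝓝 (0 : ℝ), ∀ z,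
      z ∈ (F ε).charpoly.roots.filter (fun z => dist z ν₀ < r) → ‖z - ν₀‖ ≤ K * ε ^ 2 := by
    filter_upwards [hK] with ε hε z hz
    obtain ⟨hz1, hz2⟩ := Multiset.mem_filter.1 hz
    obtain ⟨H, hH, hzH⟩ := exists_mul_eq_smul_of_mem_roots hz1
    exact hε z H hH hzH (hz2.le.trans (min_le_right _ _))
  refine ⟨fun ε => (p ε).1, fun ε => (p ε).2, ⟨r, hr0, ?_⟩, ?_, ?_⟩
  · filter_upwards [hp] with ε hε
    refine ⟨(F ε).charpoly.roots.filter (fun z => ¬ dist z ν₀ < r), ?_, fun z hz => ?_⟩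
    · rw [← hε, Multiset.filter_add_not]
    · exact not_lt.1 (Multiset.mem_filter.1 hz).2
  · refine IsBigO.of_bound K ?_
    filter_upwards [hp, hbound] with ε hε hb
    simpa using hb (p ε).1 (by rw [hε]; simp)
  · refine IsBigO.of_bound K ?_
    filter_upwards [hp, hbound] with ε hε hb
    simpa using hb (p ε).2 (by rw [hε]; simp)

end FloquetMatrices

/-! ### Expansion of the modulated Hill system. -/

section HillExpansion

variable {N : ℕ}

/-- The entries of the static Hill matrix. -/
noncomputable def staticEntry (c : ℝ) (vol : Fin N → ℝ) (C : Matrix (Fin N) (Fin N) ℝ)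
    (κ : Fin N → ℝ) (i j : Fin N) : ℝ :=
  c * (√(κ i) / vol i * C i j * √(κ j))

/-- The first-order coefficient of the Hill matrix. -/
noncomputable def hillFirst (B : Fin N → Fin N → ℝ) (Ω : ℝ) (φ : Fin N → ℝ) (t : ℝ) :
    Matrix (Fin N) (Fin N) ℝ :=
  fun i j => B i j * (Real.cos (Ω * t + φ j) - Real.cos (Ω * t + φ i))

/-- The first-order coefficient of the first-order system. -/
noncomputable def firstOrderFirst (B : Fin N → Fin N → ℝ) (Ω : ℝ) (φ : Fin N → ℝ) (t : ℝ) :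
    Matrix (Fin N ⊕ Fin N) (Fin N ⊕ Fin N) ℂ :=
  Matrix.fromBlocks 0 0 (-((hillFirst B Ω φ t).map Complex.ofReal)) 0

/-- Constant κ removes the W₃ term, and the modulation enters only through the ratio ρ_i / ρ_j. -/
lemma hillMatrix_rhoMod_apply (ρ₀ ρr κr Ω : ℝ) (vol : Fin N → ℝ) (C : Matrix (Fin N) (Fin N) ℝ)
    (κ φ : Fin N → ℝ) (ε t : ℝ) (i j : Fin N) :
    hillMatrix ρ₀ ρr κr vol C (rhoMod Ω φ ε) (fun i _ => κ i) t i j =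
      staticEntry ((ρr / ρ₀) * κr / ρr) vol C κ i j *
        ((1 + ε * Real.cos (Ω * t + φ j)) / (1 + ε * Real.cos (Ω * t + φ i))) := by
  have h0 : (Matrix.diagonal fun i : Fin N =>
      √(κ i) / 2 * deriv (fun s => deriv (fun _ : ℝ => κ i) s / (κ i) ^ (3 / 2 : ℝ)) t) = 0 := by
    simp
  rw [hillMatrix, h0, add_zero, Matrix.smul_apply, Matrix.mul_diagonal, Matrix.diagonal_mul]
  simp only [staticEntry, rhoMod, smul_eq_mul, one_div, div_inv_eq_mul]
  ring

/-- The remainder is exactly -ε² (x - y) y / (1 + ε y), with |(x - y) y| ≤ 2 and denominator at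
least 1/2. -/
lemma abs_quotient_sub_le {ε x y : ℝ} (hε : |ε| ≤ 1 / 2) (hx : |x| ≤ 1) (hy : |y| ≤ 1) :
    |(1 + ε * x) / (1 + ε * y) - 1 - ε * (x - y)| ≤ 4 * ε ^ 2 := by
  have hεy : |ε * y| ≤ 1 / 2 := by
    rw [abs_mul]; nlinarith [abs_nonneg ε, abs_nonneg y]
  have hpos : 1 / 2 ≤ 1 + ε * y := by linarith [(abs_le.1 hεy).1]
  have hne : 1 + ε * y ≠ 0 := by linarith
  have heq : (1 + ε * x) / (1 + ε * y) - 1 - ε * (x - y) =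
      -(ε ^ 2 * ((x - y) * y)) / (1 + ε * y) := by
    field_simp; ring
  have hxy : |(x - y) * y| ≤ 2 := by
    rw [abs_mul]
    have : |x - y| ≤ 2 := (abs_sub x y).trans (by linarith)
    nlinarith [abs_nonneg (x - y), abs_nonneg y]
  rw [heq, abs_div, abs_neg, abs_mul, abs_of_nonneg (sq_nonneg ε),
    abs_of_pos (by linarith : 0 < 1 + ε * y), div_le_iff₀ (by linarith)]
  nlinarith [mul_le_mul_of_nonneg_left hxy (sq_nonneg ε), sq_nonneg ε,
    mul_le_mul_of_nonneg_left hpos (sq_nonneg ε)]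

/-- The unmodulated matrix is constant in time, so its time s is independent of t. -/
lemma norm_firstOrder_sub_le {M : ℝ → ℝ → Matrix (Fin N) (Fin N) ℝ} {B : Fin N → Fin N → ℝ}
    {Ω : ℝ} {φ : Fin N → ℝ}
    (hM : ∀ ε t i j, M ε t i j =
      B i j * ((1 + ε * Real.cos (Ω * t + φ j)) / (1 + ε * Real.cos (Ω * t + φ i))))
    {ε : ℝ} (hε : |ε| ≤ 1 / 2) (s t : ℝ) (i j : Fin N ⊕ Fin N) :
    ‖firstOrder (M ε) t i j - firstOrder (M 0) s i j - ε * firstOrderFirst B Ω φ t i j‖ ≤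
      (4 * ∑ i, ∑ j, |B i j|) * ε ^ 2 := by
  have hK : 0 ≤ (4 * ∑ i, ∑ j, |B i j|) * ε ^ 2 := by positivity
  rcases i with i | i <;> rcases j with j | j
  · simpa [firstOrder, firstOrderFirst] using hK
  · simpa [firstOrder, firstOrderFirst] using hK
  · have h1 : firstOrder (M ε) t (Sum.inr i) (Sum.inl j) - firstOrder (M 0) s (Sum.inr i) (Sum.inl j)
        - ε * firstOrderFirst B Ω φ t (Sum.inr i) (Sum.inl j) =
        -((B i j * ((1 + ε * Real.cos (Ω * t + φ j)) / (1 + ε * Real.cos (Ω * t + φ i)) - 1 -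
          ε * (Real.cos (Ω * t + φ j) - Real.cos (Ω * t + φ i))) : ℝ) : ℂ) := by
      simp only [firstOrder, firstOrderFirst, hillFirst, Matrix.fromBlocks_apply₂₁,
        Matrix.neg_apply, Matrix.map_apply, hM]
      push_cast
      simp
      ring
    rw [h1, norm_neg, Complex.norm_real, Real.norm_eq_abs, abs_mul]
    have h2 := abs_quotient_sub_le hε (Real.abs_cos_le_one (Ω * t + φ j))
      (Real.abs_cos_le_one (Ω * t + φ i))
    have h3 : |B i j| ≤ ∑ i, ∑ j, |B i j| :=
      (Finset.single_le_sum (f := fun j => |B i j|) (fun _ _ => abs_nonneg _)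
        (Finset.mem_univ j)).trans
      (Finset.single_le_sum (f := fun i => ∑ j, |B i j|)
        (fun _ _ => Finset.sum_nonneg fun _ _ => abs_nonneg _) (Finset.mem_univ i))
    calc _ ≤ (∑ i, ∑ j, |B i j|) * (4 * ε ^ 2) :=
          mul_le_mul h3 h2 (abs_nonneg _) ((abs_nonneg _).trans h3)
      _ = _ := by ring
  · simpa [firstOrder, firstOrderFirst] using hK

lemma integral_cos_period {Ω : ℝ} (hΩ : 0 < Ω) (θ : ℝ) :
    ∫ t in (0 : ℝ)..(2 * Real.pi / Ω), Real.cos (Ω * t + θ) = 0 := by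
  have h1 : Ω * (2 * Real.pi / Ω) + θ = θ + 2 * Real.pi := by field_simp; ring
  rw [intervalIntegral.integral_comp_mul_add _ hΩ.ne', integral_cos, h1, Real.sin_add_two_pi]
  simp

lemma continuous_firstOrderFirst (B : Fin N → Fin N → ℝ) (Ω : ℝ) (φ : Fin N → ℝ)
    (i j : Fin N ⊕ Fin N) : Continuous fun t => firstOrderFirst B Ω φ t i j := by
  rcases i with i | i <;> rcases j with j | j <;>
    simp only [firstOrderFirst, hillFirst, Matrix.fromBlocks_apply₁₁, Matrix.fromBlocks_apply₁₂,
      Matrix.fromBlocks_apply₂₁, Matrix.fromBlocks_apply₂₂, Matrix.neg_apply, Matrix.map_apply] <;>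
    fun_prop

lemma integral_firstOrderFirst (B : Fin N → Fin N → ℝ) {Ω : ℝ} (hΩ : 0 < Ω) (φ : Fin N → ℝ)
    (i j : Fin N ⊕ Fin N) :
    ∫ t in (0 : ℝ)..(2 * Real.pi / Ω), firstOrderFirst B Ω φ t i j = 0 := by
  rcases i with i | i <;> rcases j with j | j
  · simp [firstOrderFirst]
  · simp [firstOrderFirst]
  · simp only [firstOrderFirst, hillFirst, Matrix.fromBlocks_apply₂₁, Matrix.neg_apply,
      Matrix.map_apply]
    have hi : ∀ θ, IntervalIntegrable (fun t => Real.cos (Ω * t + θ)) volume 0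
        (2 * Real.pi / Ω) := fun θ =>
      Continuous.intervalIntegrable (by fun_prop) _ _
    rw [intervalIntegral.integral_neg, intervalIntegral.integral_ofReal,
      intervalIntegral.integral_const_mul, intervalIntegral.integral_sub (hi _) (hi _),
      integral_cos_period hΩ, integral_cos_period hΩ]
    simp
  · simp [firstOrderFirst]

/-- Eigenvectors of `M` at `-μ²` give eigenvectors of the first-order system at `μ`. -/
lemma finrank_eigSpace_firstOrder_ge {M : ℝ → Matrix (Fin N) (Fin N) ℝ} {t : ℝ} {lam μ : ℂ}
    (hμ : μ ^ 2 = -lam) :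
    Module.finrank ℂ (eigSpace ((M t).map Complex.ofReal) lam) ≤
      Module.finrank ℂ (eigSpace (firstOrder M t) μ) := by
  set L : (Fin N → ℂ) →ₗ[ℂ] (Fin N ⊕ Fin N → ℂ) :=
    { toFun := fun v => Sum.elim v (μ • v)
      map_add' := fun v w => by ext (i | i) <;> simp
      map_smul' := fun c v => by ext (i | i) <;> simp [mul_left_comm] } with hL
  have hLa : ∀ v, L v = Sum.elim v (μ • v) := fun _ => rfl
  have hinj : Function.Injective L := fun v w h => funext fun i => congrFun h (Sum.inl i)
  rw [(Submodule.equivMapOfInjective L hinj _).finrank_eq]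
  refine Submodule.finrank_mono ?_
  rintro _ ⟨v, hv, rfl⟩
  have hv' := mem_eigSpace.1 hv
  rw [mem_eigSpace, hLa, firstOrder, Matrix.fromBlocks_mulVec]
  simp only [Sum.elim_comp_inl, Sum.elim_comp_inr, Matrix.zero_mulVec, Matrix.one_mulVec, zero_add,
    add_zero, Matrix.neg_mulVec, hv']
  ext (i | i)
  · simp
  · simp only [Sum.elim_inr, Pi.neg_apply, Pi.smul_apply, smul_eq_mul]
    rw [← mul_assoc, ← pow_two, hμ, neg_mul]

end HillExpansion

/-! ### Assembly for the Hill system. -/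

section Conclusion

open scoped Matrix.Norms.Operator

variable {N : ℕ}

lemma edge_eigenvalue_splitting {M : ℝ → ℝ → Matrix (Fin N) (Fin N) ℝ} {B : Fin N → Fin N → ℝ}
    {Ω : ℝ} (hΩ : 0 < Ω) {φ : Fin N → ℝ}
    (hM : ∀ ε t i j, M ε t i j =
      B i j * ((1 + ε * Real.cos (Ω * t + φ j)) / (1 + ε * Real.cos (Ω * t + φ i))))
    {F : ℝ → Matrix (Fin N ⊕ Fin N) (Fin N ⊕ Fin N) ℂ}
    (hF : ∀ᶠ ε in 𝓝 (0 : ℝ), IsFloquetMatrix (firstOrder (M ε)) (2 * Real.pi / Ω) (F ε))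
    (hFc : ContinuousAt F 0) (hF₀ : IsFolded Ω (F 0)) {lam μ ν₀ : ℂ} {k : ℤ}
    (hμ : μ ^ 2 = -lam) (hν₀ : μ = ν₀ + Complex.I * (k * Ω))
    (hlam : Module.finrank ℂ (eigSpace ((M 0 0).map Complex.ofReal) lam) = 2)
    (hmult : (F 0).charpoly.rootMultiplicity ν₀ = 2) :
    Module.finrank ℂ (eigSpace (F 0) ν₀) = 2 ∧
    (∃ F₁ P : Matrix (Fin N ⊕ Fin N) (Fin N ⊕ Fin N) ℂ,
      (∀ i j, HasDerivAt (fun ε => F ε i j) (F₁ i j) 0) ∧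
      IsEigenprojection (F 0) ν₀ P ∧ P * F₁ * P = 0) ∧
    ∃ νw νq : ℝ → ℂ,
      (∃ r : ℝ, 0 < r ∧ ∀ᶠ ε in 𝓝 (0 : ℝ), ∃ S : Multiset ℂ,
        (F ε).charpoly.roots = {νw ε, νq ε} + S ∧ ∀ z ∈ S, r ≤ dist z ν₀) ∧
      νw 0 = ν₀ ∧ νq 0 = ν₀ ∧
      HasDerivAt νw 0 0 ∧ HasDerivAt νq 0 0 ∧
      ((fun ε => νw ε - ν₀) =O[𝓝 0] fun ε : ℝ => ε ^ 2) ∧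
      ((fun ε => νq ε - ν₀) =O[𝓝 0] fun ε : ℝ => ε ^ 2) := by
  have hsmall : ∀ᶠ ε in 𝓝 (0 : ℝ), |ε| ≤ 1 / 2 := by
    filter_upwards [Metric.closedBall_mem_nhds (0 : ℝ) one_half_pos] with ε hε
    simpa using hε
  obtain ⟨hfin, F₁, P, S, hF₁, hP, hS, hPF₁⟩ := floquet_edge_expansion (a := firstOrder (M 0) 0)
    (K := 4 * ∑ i, ∑ j, |B i j|) hΩ (by positivity) (continuous_firstOrderFirst B Ω φ)
    (integral_firstOrderFirst B hΩ φ)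
    (hsmall.mono fun ε hε t i j => norm_firstOrder_sub_le hM hε 0 t i j) hF hFc hF₀ hν₀
    (hlam.symm.le.trans (finrank_eigSpace_firstOrder_ge hμ)) hmult
  obtain ⟨νw, νq, hroots, hw, hq⟩ := exists_eigenvalue_splitting hFc hF₁ hP hS hPF₁ hmult
  -- The bound holds at ε = 0 too, which pins the chosen branches to ν₀ there.
  have hzero : ∀ {ν : ℝ → ℂ}, ((fun ε => ν ε - ν₀) =O[𝓝 0] fun ε : ℝ => ε ^ 2) → ν 0 = ν₀ := by
    intro ν h
    obtain ⟨C, hC⟩ := h.bound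
    simpa [sub_eq_zero] using hC.self_of_nhds
  have hderiv : ∀ {ν : ℝ → ℂ}, ((fun ε => ν ε - ν₀) =O[𝓝 0] fun ε : ℝ => ε ^ 2) →
      HasDerivAt ν 0 0 := fun h => hasDerivAt_of_isBigO_sq (by simpa [hzero h] using h)
  exact ⟨hfin, ⟨F₁, P, hasDerivAt_matrix.1 (hasDerivAt_of_isBigO_sq hF₁), hP, hPF₁⟩, νw, νq, hroots,
    hzero hw, hzero hq, hderiv hw, hderiv hq, hw, hq⟩

end Conclusion

lemma hasDerivAt_firstOrder {N : ℕ} {M : ℝ → ℝ → Matrix (Fin N) (Fin N) ℝ}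
    {B : Fin N → Fin N → ℝ} {Ω : ℝ} {φ : Fin N → ℝ}
    (hM : ∀ ε t i j, M ε t i j =
      B i j * ((1 + ε * Real.cos (Ω * t + φ j)) / (1 + ε * Real.cos (Ω * t + φ i))))
    (t : ℝ) (i j : Fin N ⊕ Fin N) :
    HasDerivAt (fun ε => firstOrder (M ε) t i j) (firstOrderFirst B Ω φ t i j) 0 := by
  refine hasDerivAt_of_isBigO_sq (IsBigO.of_bound (4 * ∑ i, ∑ j, |B i j|) ?_)
  filter_upwards [Metric.closedBall_mem_nhds (0 : ℝ) one_half_pos] with ε hε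
  have := norm_firstOrder_sub_le hM (by simpa using hε) t t i j
  simpa using this

end TimeModulation

theorem mainTheorem2 {N : ℕ} (D : TimeModulation.Resonators N)
    -- real error matrix, by which the capacitance matrix may be corrected (possibly zero)
    (E : Matrix (Fin N) (Fin N) ℝ)
    -- material constants, modulation frequency and phase shifts
    (ρ₀ ρr κr Ω : ℝ) (hρ₀ : 0 < ρ₀) (hρr : 0 < ρr) (hκr : 0 < κr) (hΩ : 0 < Ω)
    (κ : Fin N → ℝ) (hκ : ∀ i, 0 < κ i) (φ : Fin N → ℝ)
    -- the Hill matrix and the coefficient matrix of the first-order system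
    (M : ℝ → ℝ → Matrix (Fin N) (Fin N) ℝ)
    (hM : M = fun ε => TimeModulation.hillMatrix ρ₀ ρr κr D.vol (D.capacitance + E)
      (TimeModulation.rhoMod Ω φ ε) (fun i _ => κ i))
    (A : ℝ → ℝ → Matrix (Fin N ⊕ Fin N) (Fin N ⊕ Fin N) ℂ)
    (hA : A = fun ε => TimeModulation.firstOrder (M ε))
    -- the Floquet matrices, continuous at `ε = 0`
    (F : ℝ → Matrix (Fin N ⊕ Fin N) (Fin N ⊕ Fin N) ℂ)
    (hF : ∀ᶠ ε in 𝓝 (0 : ℝ),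
      TimeModulation.IsFloquetMatrix (A ε) (2 * Real.pi / Ω) (F ε))
    (hFc : ContinuousAt F 0) (hF₀ : TimeModulation.IsFolded Ω (F 0))
    -- the edge eigenvalue: `lam` is a double eigenvalue of the static matrix, `μ ^ 2 = -lam`,
    -- and `ν₀` is `μ` folded
    (lam μ ν₀ : ℂ) (k : ℤ) (hμ : μ ^ 2 = -lam) (hν₀ : μ = ν₀ + Complex.I * (k * Ω))
    (hlam : Module.finrank ℂ
      (TimeModulation.eigSpace ((M 0 0).map Complex.ofReal) lam) = 2)
    (hmult : (F 0).charpoly.rootMultiplicity ν₀ = 2) :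
    -- the first-order coefficient `A₁` has vanishing constant Fourier coefficient
    (∃ A₁ : ℝ → Matrix (Fin N ⊕ Fin N) (Fin N ⊕ Fin N) ℂ,
      (∀ t i j, HasDerivAt (fun ε => A ε t i j) (A₁ t i j) 0) ∧
      (∀ i j, Continuous fun t => A₁ t i j) ∧
      ∀ i j, ∫ t in (0 : ℝ)..(2 * Real.pi / Ω), A₁ t i j = 0) ∧
    -- `F_ε = F₀ + ε F₁ + o(ε)` and `P F₁ P = 0`, `P` projecting onto the 2-dim. eigenspace
    Module.finrank ℂ (TimeModulation.eigSpace (F 0) ν₀) = 2 ∧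
    (∃ F₁ P : Matrix (Fin N ⊕ Fin N) (Fin N ⊕ Fin N) ℂ,
      (∀ i j, HasDerivAt (fun ε => F ε i j) (F₁ i j) 0) ∧
      TimeModulation.IsEigenprojection (F 0) ν₀ P ∧ P * F₁ * P = 0) ∧
    -- the eigenvalue splits into `νw` and `νq`, whose first-order coefficients vanish
    ∃ νw νq : ℝ → ℂ,
      (∃ r : ℝ, 0 < r ∧ ∀ᶠ ε in 𝓝 (0 : ℝ), ∃ S : Multiset ℂ,
        (F ε).charpoly.roots = {νw ε, νq ε} + S ∧ ∀ z ∈ S, r ≤ dist z ν₀) ∧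
      νw 0 = ν₀ ∧ νq 0 = ν₀ ∧
      HasDerivAt νw 0 0 ∧ HasDerivAt νq 0 0 ∧
      ((fun ε => νw ε - ν₀) =O[𝓝 0] fun ε : ℝ => ε ^ 2) ∧
      ((fun ε => νq ε - ν₀) =O[𝓝 0] fun ε : ℝ => ε ^ 2) := by
  subst hM hA
  have hM := TimeModulation.hillMatrix_rhoMod_apply ρ₀ ρr κr Ω D.vol (D.capacitance + E) κ φ
  exact ⟨⟨TimeModulation.firstOrderFirst _ Ω φ, TimeModulation.hasDerivAt_firstOrder hM,
    TimeModulation.continuous_firstOrderFirst _ Ω φ,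
    TimeModulation.integral_firstOrderFirst _ hΩ φ⟩,
    TimeModulation.edge_eigenvalue_splitting hΩ hM hF hFc hF₀ hμ hν₀ hlam hmult⟩
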